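/- Let $\alpha,\beta,\sigma>0$ and $\delta,\mu\in\mathbb R$. Let $\mathrm{BGGL}(\alpha,\beta,\delta,\mu,\sigma)$ be the distribution of $(X,\ \delta+\mu X+\sigma\sqrt X\,Z)$, where $X$ has the gamma density $\frac{\beta^\alpha}{\Gamma(\alpha)}x^{\alpha-1}e^{-\beta x}$, $x>0$, and $Z\sim\mathcal N(0,1)$ is independent of $X$. For each $n$, let $(X_1,Y_1),\dots,(X_n,Y_n)$ be a random sample (i.i.d. pairs) of size $n$ from this distribution. Write $\overline U=\frac1n\sum_{i=1}^n U_i$ and define, for $n\ge 2$, $$\hat\delta_n=\frac{\overline Y\,(\overline X)^{-1}-\overline{X^{-1}Y}}{(\overline X)^{-1}-\overline{X^{-1}}},\qquad \hat\mu_n=\frac{\overline Y-\hat\delta_n}{\overline X},\qquad \hat\upsilon_n=\frac1n\sum_{i=1}^n\left[X_i^{-1/2}Y_i-X_i^{-1/2}\hat\delta_n-X_i^{1/2}\hat\mu_n\right]^2,$$ and $s^2=\frac{n}{n-2}\hat\upsilon_n$ for $n\ge 3$. (Almost surely the $X_i$ are not all equal and these are well defined.) Then: 1. For every $n\ge3$,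 $\hat\delta_n$ is integrable and $\mathbb E\,\hat\delta_n=\delta$. For every $n\ge 3$ with $n\alpha>\tfrac12$, $\hat\mu_n$ is integrable and $\mathbb E\,\hat\mu_n=\mu$. 2. For every $n\ge2$, almost surely, the matrix $\begin{bmatrix}\sum X_k^{-1}&n\\ n&\sum X_k\end{bmatrix}$ is positive definite and the conditional distribution of $(\hat\delta_n,\hat\mu_n)$ given $X_1,\dots,X_n$ is the bivariate Gaussian distribution $$\mathcal N_2\left(\begin{bmatrix}\delta\\ \mu\end{bmatrix},\ \sigma^2\begin{bmatrix}\sum X_k^{-1}&n\\ n&\sum X_k\end{bmatrix}^{-1}\right).$$ 3. For every $n\ge2$, $\hat\upsilon_n$ is integrable and $\mathbb E\,\hat\upsilon_n\ne\sigma^2$ (it is biased), while $\mathbb E\,\hat\upsilon_n\to\sigma^2$ as $n\to\infty$ (it is asymptotically unbiased). 4. For every $n\ge3$, $s^2$ is integrable with $\mathbb E\,s^2=\sigma^2$, and $(n-2)s^2/\sigma^2\sim\chi^2_{n-2}$. -/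

import Mathlib

open MeasureTheory ProbabilityTheory Filter Topology
open scoped BigOperators

noncomputable section

namespace BGGL

/-- The distribution `BGGL(α, β, δ, μ, σ)`: the law of `(X, δ + μ X + σ √X Z)`, where `X` is gamma
distributed with shape `α` and rate `β`, `Z` is standard normal, and `X`, `Z` are independent. -/
def law (α β δ μ σ : ℝ) : Measure (ℝ × ℝ) :=
  ((gammaMeasure α β).prod (gaussianReal 0 1)).map
    (fun p : ℝ × ℝ => (p.1, δ + μ * p.1 + σ * √p.1 * p.2))

/-- `(X 0, Y 0), …, (X (n-1), Y (n-1))` is a random sample (independent, identically distributed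
pairs) of size `n` from `BGGL(α, β, δ, μ, σ)`. -/
structure IsSample {Ω : Type*} [MeasurableSpace Ω] (P : Measure Ω) {n : ℕ}
    (X Y : Fin n → Ω → ℝ) (α β δ μ σ : ℝ) : Prop where
  indep : iIndepFun (fun (i : Fin n) (ω : Ω) => (X i ω, Y i ω)) P
  hasLaw : ∀ i, HasLaw (fun ω => (X i ω, Y i ω)) (law α β δ μ σ) P

/-- The empirical average of `u 0, …, u (n-1)`. -/
def avg {n : ℕ} (u : Fin n → ℝ) : ℝ := (∑ i, u i) / n

/-- The estimator of `δ` computed from the data `(x i, y i)`. -/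
def deltaHat {n : ℕ} (x y : Fin n → ℝ) : ℝ :=
  (avg y * (avg x)⁻¹ - avg (fun i => (x i)⁻¹ * y i)) / ((avg x)⁻¹ - avg (fun i => (x i)⁻¹))

/-- The estimator of `μ`. -/
def muHat {n : ℕ} (x y : Fin n → ℝ) : ℝ := (avg y - deltaHat x y) / avg x

/-- The estimator of `υ = σ²`. -/
def upsilonHat {n : ℕ} (x y : Fin n → ℝ) : ℝ :=
  1 / (n : ℝ) *
    ∑ i, ((√(x i))⁻¹ * y i - (√(x i))⁻¹ * deltaHat x y - √(x i) * muHat x y) ^ 2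

/-- The corrected estimator `s²` of `σ²`. -/
def sSq {n : ℕ} (x y : Fin n → ℝ) : ℝ := (n : ℝ) / ((n : ℝ) - 2) * upsilonHat x y

/-- The value at the outcome `ω` of a statistic `T` of the sample `(X i, Y i)`. -/
def eval {Ω : Type*} {n : ℕ} (T : (Fin n → ℝ) → (Fin n → ℝ) → ℝ) (X Y : Fin n → Ω → ℝ) (ω : Ω) :
    ℝ :=
  T (fun i => X i ω) (fun i => Y i ω)

/-- The random variable `T` is an unbiased estimator of `θ`: its expectation exists and is `θ`. -/
def IsUnbiased {Ω : Type*} [MeasurableSpace Ω] (P : Measure Ω) (T : Ω → ℝ) (θ : ℝ) : Prop :=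
  Integrable T P ∧ ∫ ω, T ω ∂P = θ

/-- The random variable `T` is a biased estimator of `θ`: its expectation exists and is not `θ`. -/
def IsBiased {Ω : Type*} [MeasurableSpace Ω] (P : Measure Ω) (T : Ω → ℝ) (θ : ℝ) : Prop :=
  Integrable T P ∧ ∫ ω, T ω ∂P ≠ θ

/-- The chi-squared distribution with `k` degrees of freedom: the law of the sum of the squares of
`k` independent standard normal variables. -/
def chiSquared (k : ℕ) : Measure ℝ :=
  (Measure.pi (fun _ : Fin k => gaussianReal 0 1)).map (fun z => ∑ i, z i ^ 2)

/-- The matrix with rows `(∑ 1 / x k, n)` and `(n, ∑ x k)`. -/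
def infoMatrix {n : ℕ} (x : Fin n → ℝ) : Matrix (Fin 2) (Fin 2) ℝ :=
  !![∑ k, (x k)⁻¹, (n : ℝ); (n : ℝ), ∑ k, x k]

end BGGL

end

/-! ### Samples as gamma covariates with independent Gaussian noise -/

noncomputable section

namespace BGGL

open Matrix WithLp
open scoped RealInnerProductSpace ENNReal

/-! Given X = x, dividing the i-th response by √xᵢ yields the Gaussian linear model w = δa + μb + σz
with regressors a = (1/√xᵢ), b = (√xᵢ) and z standard Gaussian. The Gram matrix of a, b is
`infoMatrix x`, and the estimators are ordinary least squares. Their errors are σ⟪c, z⟫ with c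
running through the basis dual to a, b, whose Gram matrix is the inverse one; this is the
conditional law. The residual is σ times the projection of z onto the complement of a, b
(`upsilonHat_respond`), so nυ̂/σ² is chi-squared with n - 2 degrees of freedom for almost every x,
hence unconditionally.

Conditional errors are centred, so unbiasedness is a question of integrability: with S = ∑ xᵢ, H = ∑
1/xᵢ and D = SH - n², it suffices that √(S/D) and √(H/D) have finite mean. D vanishes when all xᵢ
coincide, and the singularity is controlled with three points: D is at least A² + B² ≥ AB for two
pairs with a common point, so D^(-1/2) splits into two factors `prox` (`inv_sqrt_infoDet_le`), each
singular only like |t - s|^(-1/2). These integrate uniformly in the common point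
(`exists_lintegral_prox_le`). For μ, writing H/D = (1 + n²/D)/S leaves the factor S^(-1/2), at most
∏ xᵢ^(-1/(2n)) by AM-GM; its mean is finite when 1/(2n) < α. -/

/-- The responses `δ + μ xᵢ + σ √xᵢ zᵢ` with covariates `x` and noise `z`. -/
def respond (δ μ σ : ℝ) {n : ℕ} (x : Fin n → ℝ) (z : EuclideanSpace ℝ (Fin n)) : Fin n → ℝ :=
  fun i => δ + μ * x i + σ * √(x i) * z i

@[fun_prop]
lemma measurable_respond (δ μ σ : ℝ) {n : ℕ} :
    Measurable (fun p : (Fin n → ℝ) × EuclideanSpace ℝ (Fin n) => respond δ μ σ p.1 p.2) := by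
  unfold respond
  fun_prop

/-- The law of `n` independent gamma variables. -/
def gammaPi (α β : ℝ) (n : ℕ) : Measure (Fin n → ℝ) := Measure.pi fun _ => gammaMeasure α β

lemma isProbabilityMeasure_gammaPi {α β : ℝ} (hα : 0 < α) (hβ : 0 < β) (n : ℕ) :
    IsProbabilityMeasure (gammaPi α β n) := by
  have := isProbabilityMeasure_gammaMeasure hα hβ
  unfold gammaPi
  infer_instance

lemma IsSample.hasLaw_pair {Ω : Type*} [MeasurableSpace Ω] {P : Measure Ω}
    [IsProbabilityMeasure P] {n : ℕ} {X Y : Fin n → Ω → ℝ} {α β δ μ σ : ℝ}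
    (hα : 0 < α) (hβ : 0 < β) (h : IsSample P X Y α β δ μ σ) :
    HasLaw (fun ω => ((fun i => X i ω), (fun i => Y i ω)))
      (((gammaPi α β n).prod (stdGaussian (EuclideanSpace ℝ (Fin n)))).map
        (fun p => (p.1, respond δ μ σ p.1 p.2))) P := by
  have := isProbabilityMeasure_gammaMeasure hα hβ
  have := isProbabilityMeasure_gammaPi hα hβ n
  have hf : Measurable (fun p : ℝ × ℝ => (p.1, δ + μ * p.1 + σ * √p.1 * p.2)) := by fun_prop
  have := Measure.isProbabilityMeasure_map (μ := (gammaMeasure α β).prod (gaussianReal 0 1))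
    hf.aemeasurable
  have hm : ∀ i, AEMeasurable (fun ω => (X i ω, Y i ω)) P := fun i => (h.hasLaw i).aemeasurable
  have hm' : AEMeasurable (fun ω i => (X i ω, Y i ω)) P := aemeasurable_pi_lambda _ hm
  have key : P.map (fun ω i => (X i ω, Y i ω)) =
      (Measure.pi fun _ : Fin n => (gammaMeasure α β).prod (gaussianReal 0 1)).map
        (fun p i => ((p i).1, δ + μ * (p i).1 + σ * √(p i).1 * (p i).2)) := by
    rw [(iIndepFun_iff_map_fun_eq_pi_map hm).1 h.indep,
      Measure.pi_map_pi (f := fun _ (p : ℝ × ℝ) => (p.1, δ + μ * p.1 + σ * √p.1 * p.2))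
        (fun _ => hf.aemeasurable)]
    congr with i : 1
    exact (h.hasLaw i).map_eq
  have hunzip : Measurable (fun q : Fin n → ℝ × ℝ => ((fun i => (q i).1), (fun i => (q i).2))) := by
    fun_prop
  refine ⟨hunzip.comp_aemeasurable hm', ?_⟩
  -- Regroups n independent (covariate, noise) pairs into a covariate vector and an independent
  -- noise vector.
  have hpi : ((gammaPi α β n).prod (stdGaussian (EuclideanSpace ℝ (Fin n)))) =
      (Measure.pi fun _ : Fin n => (gammaMeasure α β).prod (gaussianReal 0 1)).map
        (fun q => ((fun i => (q i).1), toLp 2 (fun i => (q i).2))) := by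
    have e := (measurePreserving_arrowProdEquivProdArrow ℝ ℝ (Fin n)
      (fun _ => gammaMeasure α β) (fun _ => gaussianReal 0 1)).map_eq
    have : (gammaPi α β n) = (gammaPi α β n).map id := by simp
    rw [this, ← map_pi_eq_stdGaussian, Measure.map_prod_map _ _ (by fun_prop) (by fun_prop),
      gammaPi, ← e, Measure.map_map (by fun_prop) (by fun_prop)]
    rfl
  rw [hpi, Measure.map_map (by fun_prop) (by fun_prop)]
  have := congrArg (Measure.map
    (fun q : Fin n → ℝ × ℝ => ((fun i => (q i).1), (fun i => (q i).2)))) key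
  rw [AEMeasurable.map_map_of_aemeasurable hunzip.aemeasurable hm',
    Measure.map_map hunzip (by fun_prop)] at this
  exact this

/-! ### Least squares -/

section Algebra

variable {n : ℕ} {x : Fin n → ℝ}

/-- The regressor `(1 / √xᵢ)ᵢ`. -/
def invSqrtVec (x : Fin n → ℝ) : EuclideanSpace ℝ (Fin n) := toLp 2 fun i => (√(x i))⁻¹

/-- The regressor `(√xᵢ)ᵢ`. -/
def sqrtVec (x : Fin n → ℝ) : EuclideanSpace ℝ (Fin n) := toLp 2 fun i => √(x i)

/-- The determinant of `infoMatrix x`. -/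
def infoDet (x : Fin n → ℝ) : ℝ := (∑ i, x i) * (∑ i, (x i)⁻¹) - (n : ℝ) ^ 2

lemma inner_invSqrtVec_self (hx : ∀ i, 0 < x i) :
    ⟪invSqrtVec x, invSqrtVec x⟫ = ∑ i, (x i)⁻¹ := by
  simp only [invSqrtVec, PiLp.inner_apply, RCLike.inner_apply, conj_trivial]
  refine Finset.sum_congr rfl fun i _ => ?_
  rw [← mul_inv, Real.mul_self_sqrt (hx i).le]

lemma inner_sqrtVec_self (hx : ∀ i, 0 < x i) : ⟪sqrtVec x, sqrtVec x⟫ = ∑ i, x i := by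
  simp only [sqrtVec, PiLp.inner_apply, RCLike.inner_apply, conj_trivial]
  exact Finset.sum_congr rfl fun i _ => Real.mul_self_sqrt (hx i).le

lemma inner_invSqrtVec_sqrtVec (hx : ∀ i, 0 < x i) : ⟪invSqrtVec x, sqrtVec x⟫ = n := by
  simp only [invSqrtVec, sqrtVec, PiLp.inner_apply, RCLike.inner_apply, conj_trivial]
  rw [Finset.sum_congr rfl (g := fun _ => (1 : ℝ))
    fun i _ => mul_inv_cancel₀ (Real.sqrt_pos.2 (hx i)).ne']
  simp

lemma inner_sqrtVec_invSqrtVec (hx : ∀ i, 0 < x i) : ⟪sqrtVec x, invSqrtVec x⟫ = n := by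
  rw [real_inner_comm, inner_invSqrtVec_sqrtVec hx]

/-- Lagrange's identity, from (a - b)²/(ab) = a/b + b/a - 2. It gives positivity and also the rate
at which the determinant degenerates. -/
lemma two_mul_infoDet (hx : ∀ i, 0 < x i) :
    2 * infoDet x = ∑ p : Fin n × Fin n, (x p.1 - x p.2) ^ 2 / (x p.1 * x p.2) := by
  have h : ∀ p : Fin n × Fin n, (x p.1 - x p.2) ^ 2 / (x p.1 * x p.2) =
      x p.1 * (x p.2)⁻¹ + (x p.1)⁻¹ * x p.2 - 2 := fun p => by
    have := (hx p.1).ne'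
    have := (hx p.2).ne'
    field_simp
    ring
  simp_rw [h, Finset.sum_sub_distrib, Finset.sum_add_distrib, Fintype.sum_prod_type,
    ← Finset.sum_mul_sum]
  simp [infoDet]
  ring

lemma infoDet_pos (hx : ∀ i, 0 < x i) {i j : Fin n} (hij : x i ≠ x j) : 0 < infoDet x := by
  have h := two_mul_infoDet hx
  have : 0 < ∑ p : Fin n × Fin n, (x p.1 - x p.2) ^ 2 / (x p.1 * x p.2) := by
    refine Finset.sum_pos' (fun p _ => ?_) ⟨(i, j), Finset.mem_univ _, ?_⟩
    · have := hx p.1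
      have := hx p.2
      positivity
    · have := hx i
      have := hx j
      have := sub_ne_zero.2 hij
      positivity
  linarith

/-- Only four ordered pairs are kept from Lagrange's sum; each unordered pair occurs twice, which
absorbs the factor 2. -/
lemma add_le_infoDet (hx : ∀ i, 0 < x i) {i j k : Fin n} (hij : i ≠ j) (hik : i ≠ k)
    (hjk : j ≠ k) :
    (x i - x j) ^ 2 / (x i * x j) + (x i - x k) ^ 2 / (x i * x k) ≤ infoDet x := by
  have h := two_mul_infoDet hx
  have := Finset.sum_le_univ_sum_of_nonneg
    (f := fun p : Fin n × Fin n => (x p.1 - x p.2) ^ 2 / (x p.1 * x p.2))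
    (s := {(i, j), (j, i), (i, k), (k, i)}) (fun p => by
      have := hx p.1
      have := hx p.2
      positivity)
  rw [← h, Finset.sum_insert (by simp [*, hij.symm]), Finset.sum_insert (by simp [*, hij.symm]),
    Finset.sum_insert (by simp [*]), Finset.sum_singleton] at this
  have e (a b : ℝ) : (a - b) ^ 2 / (a * b) = (b - a) ^ 2 / (b * a) := by
    rw [mul_comm a b]
    ring
  rw [e (x j), e (x k)] at this
  linarith

lemma posDef_infoMatrix (hx : ∀ i, 0 < x i) (hD : 0 < infoDet x) : (infoMatrix x).PosDef := by
  have hn : n ≠ 0 := by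
    rintro rfl
    simp [infoDet] at hD
  have : Nonempty (Fin n) := Fin.pos_iff_nonempty.1 (Nat.pos_of_ne_zero hn)
  have hH : 0 < ∑ i, (x i)⁻¹ :=
    Finset.sum_pos (fun i _ => inv_pos.2 (hx i)) Finset.univ_nonempty
  refine Matrix.PosDef.of_dotProduct_mulVec_pos ?_ fun t ht => ?_
  · ext i j
    fin_cases i <;> fin_cases j <;> simp [infoMatrix]
  · simp only [infoMatrix, dotProduct, mulVec, Fin.sum_univ_two, star_trivial, Matrix.of_apply,
      Matrix.cons_val_zero, Matrix.cons_val_one, Pi.star_apply, Matrix.cons_val', Matrix.cons_val_fin_one]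
    set H := ∑ i, (x i)⁻¹
    set S := ∑ i, x i
    have hD' : 0 < S * H - (n : ℝ) ^ 2 := hD
    -- Completing the square, after multiplying by H > 0 to avoid division.
    have key : H * (t 0 * (H * t 0 + n * t 1) + t 1 * (n * t 0 + S * t 1)) =
        (H * t 0 + n * t 1) ^ 2 + (S * H - (n : ℝ) ^ 2) * t 1 ^ 2 := by ring
    refine pos_of_mul_pos_right (a := H) ?_ hH.le
    rw [key]
    by_cases h1 : t 1 = 0
    · have h0 : t 0 ≠ 0 := fun h0 => ht (by ext i; fin_cases i <;> simp [h0, h1])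
      rw [h1, mul_zero, add_zero, zero_pow two_ne_zero, mul_zero, add_zero]
      positivity
    · positivity

lemma inv_infoMatrix (hD : 0 < infoDet x) :
    (infoMatrix x)⁻¹ = !![(∑ i, x i) / infoDet x, -n / infoDet x;
      -n / infoDet x, (∑ i, (x i)⁻¹) / infoDet x] := by
  refine Matrix.inv_eq_right_inv ?_
  have := hD.ne'
  ext i j
  fin_cases i <;> fin_cases j <;>
    simp [infoMatrix, Matrix.mul_apply, Fin.sum_univ_two] <;> field_simp <;> simp [infoDet] <;> ring

/-- The vector representing the error of `deltaHat` as a linear function of the noise. -/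
def deltaVec (x : Fin n → ℝ) : EuclideanSpace ℝ (Fin n) :=
  ((∑ i, x i) / infoDet x) • invSqrtVec x - (n / infoDet x) • sqrtVec x

/-- The vector representing the error of `muHat` as a linear function of the noise. -/
def muVec (x : Fin n → ℝ) : EuclideanSpace ℝ (Fin n) :=
  ((∑ i, (x i)⁻¹) / infoDet x) • sqrtVec x - (n / infoDet x) • invSqrtVec x

/-- `deltaVec x` and `muVec x` form the basis dual to the two regressors, so their Gram matrix is
the inverse of `infoMatrix x`, computed entrywise here and in the next two lemmas. -/
lemma inner_deltaVec_self (hx : ∀ i, 0 < x i) (hD : 0 < infoDet x) :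
    ⟪deltaVec x, deltaVec x⟫ = (∑ i, x i) / infoDet x := by
  simp only [deltaVec, inner_sub_left, inner_sub_right, real_inner_smul_left,
    real_inner_smul_right, inner_invSqrtVec_self hx, inner_sqrtVec_self hx,
    inner_invSqrtVec_sqrtVec hx, inner_sqrtVec_invSqrtVec hx]
  have := hD.ne'
  field_simp
  simp only [infoDet]
  ring_nf

lemma inner_muVec_self (hx : ∀ i, 0 < x i) (hD : 0 < infoDet x) :
    ⟪muVec x, muVec x⟫ = (∑ i, (x i)⁻¹) / infoDet x := by
  simp only [muVec, inner_sub_left, inner_sub_right, real_inner_smul_left,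
    real_inner_smul_right, inner_invSqrtVec_self hx, inner_sqrtVec_self hx,
    inner_invSqrtVec_sqrtVec hx, inner_sqrtVec_invSqrtVec hx]
  have := hD.ne'
  field_simp
  simp only [infoDet]
  ring_nf

lemma inner_deltaVec_muVec (hx : ∀ i, 0 < x i) (hD : 0 < infoDet x) :
    ⟪deltaVec x, muVec x⟫ = -n / infoDet x := by
  simp only [deltaVec, muVec, inner_sub_left, inner_sub_right, real_inner_smul_left,
    real_inner_smul_right, inner_invSqrtVec_self hx, inner_sqrtVec_self hx,
    inner_invSqrtVec_sqrtVec hx, inner_sqrtVec_invSqrtVec hx]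
  have := hD.ne'
  field_simp
  simp only [infoDet]
  ring_nf

lemma sum_respond (x : Fin n → ℝ) (δ μ σ : ℝ) (z : EuclideanSpace ℝ (Fin n)) :
    ∑ i, respond δ μ σ x z i = n * δ + (∑ i, x i) * μ + σ * ⟪sqrtVec x, z⟫ := by
  simp only [respond, Finset.sum_add_distrib, sqrtVec, PiLp.inner_apply, RCLike.inner_apply,
    conj_trivial, Finset.mul_sum, Finset.sum_mul]
  simp only [Finset.sum_const, Finset.card_univ, Fintype.card_fin, nsmul_eq_mul]
  congr 1
  · simp [mul_comm]
  · exact Finset.sum_congr rfl fun i _ => by ring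

lemma sum_inv_mul_respond (hx : ∀ i, 0 < x i) (δ μ σ : ℝ) (z : EuclideanSpace ℝ (Fin n)) :
    ∑ i, (x i)⁻¹ * respond δ μ σ x z i =
      (∑ i, (x i)⁻¹) * δ + n * μ + σ * ⟪invSqrtVec x, z⟫ := by
  have h : ∀ i, (x i)⁻¹ * respond δ μ σ x z i =
      (x i)⁻¹ * δ + μ + σ * (z i * (√(x i))⁻¹) := fun i => by
    have h1 := Real.sqrt_pos.2 (hx i)
    have h2 := Real.sq_sqrt (hx i).le
    rw [respond]
    generalize √(x i) = s at *
    rw [← h2]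
    field_simp
  simp only [h, Finset.sum_add_distrib, invSqrtVec, PiLp.inner_apply, RCLike.inner_apply,
    conj_trivial, Finset.mul_sum, Finset.sum_mul]
  simp

/-- Cramer's rule for the normal equations: numerator and denominator of the estimator are both
multiplied by -Sn. -/
lemma deltaHat_eq_div (hx : ∀ i, 0 < x i) (hD : 0 < infoDet x) (y : Fin n → ℝ) :
    deltaHat x y = ((∑ i, x i) * (∑ i, (x i)⁻¹ * y i) - n * ∑ i, y i) / infoDet x := by
  have hn : n ≠ 0 := by
    rintro rfl
    simp [infoDet] at hD
  have : Nonempty (Fin n) := Fin.pos_iff_nonempty.1 (Nat.pos_of_ne_zero hn)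
  have hS : 0 < ∑ i, x i := Finset.sum_pos (fun i _ => hx i) Finset.univ_nonempty
  have hn' : (n : ℝ) ≠ 0 := Nat.cast_ne_zero.2 hn
  unfold deltaHat avg
  have hD' : 0 < (∑ i, x i) * (∑ i, (x i)⁻¹) - (n : ℝ) ^ 2 := hD
  unfold infoDet
  generalize (∑ i, x i) = S at *
  generalize (∑ i, (x i)⁻¹) = H at *
  generalize (∑ i, (x i)⁻¹ * y i) = A at *
  generalize (∑ i, y i) = B at *
  have hS' := hS.ne'
  have h1 : (S / n)⁻¹ - H / n = -(S * H - (n : ℝ) ^ 2) / (S * n) := by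
    field_simp
    ring
  have h2 : B / n * (S / n)⁻¹ - A / n = -(S * A - n * B) / (S * n) := by
    field_simp
    ring
  rw [h1, h2]
  have := hD'.ne'
  field_simp

lemma muHat_eq_div (hx : ∀ i, 0 < x i) (hD : 0 < infoDet x) (y : Fin n → ℝ) :
    muHat x y =
      ((∑ i, (x i)⁻¹) * (∑ i, y i) - n * ∑ i, (x i)⁻¹ * y i) / infoDet x := by
  have hn : n ≠ 0 := by
    rintro rfl
    simp [infoDet] at hD
  have : Nonempty (Fin n) := Fin.pos_iff_nonempty.1 (Nat.pos_of_ne_zero hn)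
  have hS : 0 < ∑ i, x i := Finset.sum_pos (fun i _ => hx i) Finset.univ_nonempty
  have hn' : (n : ℝ) ≠ 0 := Nat.cast_ne_zero.2 hn
  rw [muHat, deltaHat_eq_div hx hD]
  have := hD.ne'
  have := hS.ne'
  unfold avg
  field_simp
  simp only [infoDet]
  ring_nf

lemma deltaHat_respond (hx : ∀ i, 0 < x i) (hD : 0 < infoDet x) (δ μ σ : ℝ)
    (z : EuclideanSpace ℝ (Fin n)) :
    deltaHat x (respond δ μ σ x z) = δ + σ * ⟪deltaVec x, z⟫ := by
  rw [deltaHat_eq_div hx hD, sum_respond x, sum_inv_mul_respond hx, deltaVec, inner_sub_left,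
    real_inner_smul_left, real_inner_smul_left]
  have := hD.ne'
  field_simp
  simp only [infoDet]
  ring_nf

lemma muHat_respond (hx : ∀ i, 0 < x i) (hD : 0 < infoDet x) (δ μ σ : ℝ)
    (z : EuclideanSpace ℝ (Fin n)) :
    muHat x (respond δ μ σ x z) = μ + σ * ⟪muVec x, z⟫ := by
  rw [muHat_eq_div hx hD, sum_respond x, sum_inv_mul_respond hx, muVec, inner_sub_left,
    real_inner_smul_left, real_inner_smul_left]
  have := hD.ne'
  field_simp
  simp only [infoDet]
  ring_nf

/-- The orthogonal complement of the regressors. -/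
def residualSpace (x : Fin n → ℝ) : Submodule ℝ (EuclideanSpace ℝ (Fin n)) :=
  (Submodule.span ℝ (Set.range ![invSqrtVec x, sqrtVec x]))ᗮ

lemma finrank_residualSpace (hx : ∀ i, 0 < x i) (hD : 0 < infoDet x) :
    Module.finrank ℝ (residualSpace x) = n - 2 := by
  have hli : LinearIndependent ℝ ![invSqrtVec x, sqrtVec x] := by
    rw [LinearIndependent.pair_iff]
    intro s t hst
    -- Pairing the relation with each regressor gives a 2×2 linear system of determinant `infoDet
    -- x`.
    have h1 := congrArg (fun v => ⟪invSqrtVec x, v⟫) hst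
    have h2 := congrArg (fun v => ⟪sqrtVec x, v⟫) hst
    simp only [inner_add_right, real_inner_smul_right, inner_zero_right,
      inner_invSqrtVec_self hx, inner_sqrtVec_self hx,
      inner_invSqrtVec_sqrtVec hx, inner_sqrtVec_invSqrtVec hx] at h1 h2
    constructor
    · refine (mul_eq_zero.1 (?_ : infoDet x * s = 0)).resolve_left hD.ne'
      simp only [infoDet]
      linear_combination (∑ i, x i) * h1 - n * h2
    · refine (mul_eq_zero.1 (?_ : infoDet x * t = 0)).resolve_left hD.ne'
      simp only [infoDet]
      linear_combination (∑ i, (x i)⁻¹) * h2 - n * h1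
  have h := Submodule.finrank_add_finrank_orthogonal
    (Submodule.span ℝ (Set.range ![invSqrtVec x, sqrtVec x]))
  rw [finrank_span_eq_card hli] at h
  simp only [Fintype.card_fin, finrank_euclideanSpace] at h
  unfold residualSpace
  omega

/-- The rescaled residual is orthogonal to both regressors and differs from σz by a combination of
them, so it is the projection of σz; δ and μ drop out. -/
lemma upsilonHat_respond (hx : ∀ i, 0 < x i) (hD : 0 < infoDet x) (δ μ σ : ℝ)
    (z : EuclideanSpace ℝ (Fin n)) :
    upsilonHat x (respond δ μ σ x z) =
      σ ^ 2 / n * ‖(residualSpace x).orthogonalProjectionOnto z‖ ^ 2 := by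
  set y := respond δ μ σ x z with hy
  set w : EuclideanSpace ℝ (Fin n) := toLp 2 fun i => (√(x i))⁻¹ * y i with hw
  have hwz : w = δ • invSqrtVec x + μ • sqrtVec x + σ • z := by
    ext i
    have h1 := Real.sqrt_pos.2 (hx i)
    have h2 := Real.sq_sqrt (hx i).le
    simp only [hw, hy, respond, invSqrtVec, sqrtVec, PiLp.add_apply, PiLp.smul_apply, smul_eq_mul]
    generalize √(x i) = s at *
    rw [← h2]
    field_simp
  set r := w - deltaHat x y • invSqrtVec x - muHat x y • sqrtVec x with hr
  have h0 : upsilonHat x y = 1 / n * ‖r‖ ^ 2 := by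
    rw [EuclideanSpace.real_norm_sq_eq, upsilonHat]
    congr 1
    refine Finset.sum_congr rfl fun i _ => ?_
    simp only [hr, hw, invSqrtVec, sqrtVec, PiLp.sub_apply, PiLp.smul_apply, smul_eq_mul]
    ring
  have hmem : r ∈ residualSpace x := by
    rw [residualSpace, ← Submodule.span_singleton_le_iff_mem,
      ← Submodule.le_orthogonal_iff_le_orthogonal, Submodule.span_le]
    rintro _ ⟨i, rfl⟩
    rw [SetLike.mem_coe, Submodule.mem_orthogonal_singleton_iff_inner_left, hr, hwz]
    have := hD.ne'
    fin_cases i <;>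
    · simp only [hy, deltaHat_respond hx hD, muHat_respond hx hD, inner_add_right, inner_sub_right,
        real_inner_smul_right, inner_invSqrtVec_self hx, inner_sqrtVec_self hx, deltaVec, muVec,
        inner_sub_left, real_inner_smul_left,
        inner_invSqrtVec_sqrtVec hx, inner_sqrtVec_invSqrtVec hx, Fin.zero_eta, Fin.mk_one,
        Matrix.cons_val_zero, Matrix.cons_val_one]
      field_simp
      simp only [infoDet]
      ring_nf
  have hproj : ((residualSpace x).orthogonalProjectionOnto (σ • z) : EuclideanSpace ℝ (Fin n)) = r := by
    refine Submodule.eq_starProjection_of_mem_orthogonal hmem ?_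
    have : σ • z - r = (deltaHat x y - δ) • invSqrtVec x + (muHat x y - μ) • sqrtVec x := by
      rw [hr, hwz]
      module
    rw [this, residualSpace]
    refine Submodule.le_orthogonal_orthogonal _ (Submodule.add_mem _ ?_ ?_)
    · exact Submodule.smul_mem _ _ (Submodule.subset_span ⟨0, rfl⟩)
    · exact Submodule.smul_mem _ _ (Submodule.subset_span ⟨1, rfl⟩)
  rw [h0, ← hproj, map_smul, Submodule.coe_smul, Submodule.coe_norm, norm_smul, mul_pow, Real.norm_eq_abs, sq_abs]
  ring

end Algebra

end BGGL

end
noncomputable section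

namespace BGGL

open Matrix WithLp
open scoped RealInnerProductSpace ENNReal

/-! ### Images of the standard Gaussian measure -/

section Gaussian

variable {E : Type*} [NormedAddCommGroup E] [InnerProductSpace ℝ E] [FiniteDimensional ℝ E]
  [MeasurableSpace E] [BorelSpace E]

/-- For t in K, ⟪Pz, t⟫ = ⟪z, t⟫, so the characteristic functions agree. -/
lemma map_orthogonalProjection_stdGaussian (K : Submodule ℝ E) :
    (stdGaussian E).map K.orthogonalProjectionOnto = stdGaussian K := by
  have : IsProbabilityMeasure ((stdGaussian E).map K.orthogonalProjectionOnto) :=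
    Measure.isProbabilityMeasure_map (by fun_prop)
  refine Measure.ext_of_charFun ?_
  ext t
  rw [charFun_apply, integral_map (by fun_prop) (Measurable.aestronglyMeasurable (by fun_prop))]
  have h : ∀ z : E, ⟪K.orthogonalProjectionOnto z, t⟫ = ⟪z, (t : E)⟫ := fun z => by
    rw [Submodule.inner_orthogonalProjectionOnto_eq_of_mem_right]
  simp_rw [h]
  rw [← charFun_apply, charFun_stdGaussian, charFun_stdGaussian, Submodule.coe_norm]

lemma map_norm_sq_stdGaussian : (stdGaussian E).map (fun z => ‖z‖ ^ 2) =
    chiSquared (Module.finrank ℝ E) := by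
  rw [stdGaussian, Measure.map_map (by fun_prop) (by fun_prop),
    chiSquared]
  congr 1
  ext z
  have h : ∑ i, z i • stdOrthonormalBasis ℝ E i =
      (stdOrthonormalBasis ℝ E).repr.symm (toLp 2 z) := by
    rw [← OrthonormalBasis.sum_repr_symm]
  simp only [Function.comp_apply]
  rw [h, LinearIsometryEquiv.norm_map, EuclideanSpace.real_norm_sq_eq]

lemma integral_inner_stdGaussian (c : E) : ∫ z, ⟪c, z⟫ ∂(stdGaussian E) = 0 := by
  have := integral_strongDual_stdGaussian (innerSL ℝ c)
  simpa using this

lemma lintegral_enorm_inner_stdGaussian_le (c : E) :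
    ∫⁻ z, ‖⟪c, z⟫‖ₑ ∂(stdGaussian E) ≤
      ENNReal.ofReal (√⟪c, c⟫) * ∫⁻ z, ‖z‖ₑ ∂(stdGaussian E) := by
  rw [← lintegral_const_mul _ (by fun_prop), ← norm_eq_sqrt_real_inner, ofReal_norm]
  refine lintegral_mono fun z => ?_
  rw [← ofReal_norm, ← ofReal_norm, ← ofReal_norm, ← ENNReal.ofReal_mul (norm_nonneg _)]
  exact ENNReal.ofReal_le_ofReal (norm_inner_le_norm c z)

lemma lintegral_enorm_stdGaussian_ne_top : ∫⁻ z, ‖z‖ₑ ∂(stdGaussian E) ≠ ∞ :=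
  (IsGaussian.integrable_id (μ := stdGaussian E)).2.ne

/-- A pair of linear forms in a standard Gaussian vector has a bivariate Gaussian law, with
covariance given by the Gram matrix. -/
lemma map_pair_stdGaussian (a b σ : ℝ) (c d : E) {M : Matrix (Fin 2) (Fin 2) ℝ}
    (hM : M = !![⟪c, c⟫, ⟪c, d⟫; ⟪c, d⟫, ⟪d, d⟫]) (hpos : (σ ^ 2 • M).PosSemidef) :
    (stdGaussian E).map
        (fun z => (!₂[a + σ * ⟪c, z⟫, b + σ * ⟪d, z⟫] : EuclideanSpace ℝ (Fin 2))) =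
      multivariateGaussian !₂[a, b] (σ ^ 2 • M) := by
  have hmeas : Measurable
      (fun z : E => (!₂[a + σ * ⟪c, z⟫, b + σ * ⟪d, z⟫] : EuclideanSpace ℝ (Fin 2))) := by
    refine (WithLp.measurable_toLp 2 _).comp (measurable_pi_iff.2 fun i => ?_)
    fin_cases i <;> simp <;> fun_prop
  have := Measure.isProbabilityMeasure_map (μ := stdGaussian E) hmeas.aemeasurable
  refine Measure.ext_of_charFun ?_
  ext t
  rw [charFun_multivariateGaussian hpos, charFun_apply, integral_map hmeas.aemeasurable
    (Measurable.aestronglyMeasurable (by fun_prop))]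
  -- Against t, the random part is ⟪z, v⟫ with v = σ(t₀c + t₁d), and ‖v‖² is the quadratic form of
  -- σ²M at t.
  have h : ∀ z : E, ⟪(!₂[a + σ * ⟪c, z⟫, b + σ * ⟪d, z⟫] : EuclideanSpace ℝ (Fin 2)), t⟫ =
      ⟪t, !₂[a, b]⟫ + ⟪z, (σ * t 0) • c + (σ * t 1) • d⟫ := fun z => by
    rw [inner_add_right, real_inner_smul_right, real_inner_smul_right, real_inner_comm c z,
      real_inner_comm d z]
    simp [PiLp.inner_apply, Fin.sum_univ_two]
    ring
  simp_rw [h, Complex.ofReal_add, add_mul, Complex.exp_add]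
  rw [integral_const_mul, ← charFun_apply, charFun_stdGaussian, sub_eq_add_neg, Complex.exp_add,
    ← Complex.ofReal_pow, ← real_inner_self_eq_norm_sq]
  congr 3
  rw [← Complex.ofReal_neg]
  push_cast
  rw [neg_div]
  congr 2
  norm_cast
  rw [hM]
  simp only [inner_add_left, inner_add_right, real_inner_smul_left, real_inner_smul_right,
    real_inner_comm c d, dotProduct, mulVec, Fin.sum_univ_two, Matrix.smul_apply, Matrix.of_apply,
    Matrix.cons_val_zero, Matrix.cons_val_one, Matrix.cons_val', Matrix.cons_val_fin_one,
    smul_eq_mul]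
  ring

lemma memLp_two_gaussianReal : MemLp (fun z : ℝ => z) 2 (gaussianReal 0 1) :=
  IsGaussian.memLp_two_id

lemma integral_sq_gaussianReal : ∫ z, z ^ 2 ∂(gaussianReal 0 1) = 1 := by
  have h := variance_eq_sub (memLp_two_gaussianReal)
  have h' := variance_fun_id_gaussianReal (μ := 0) (v := 1)
  rw [h'] at h
  simpa using h.symm

lemma integrable_eval_sq (k : ℕ) (i : Fin k) :
    Integrable (fun z : Fin k → ℝ => z i ^ 2) (Measure.pi fun _ => gaussianReal 0 1) :=
  integrable_comp_eval (μ := fun _ : Fin k => gaussianReal 0 1) (i := i)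
    memLp_two_gaussianReal.integrable_sq

lemma integrable_chiSquared (k : ℕ) : Integrable (fun t => t) (chiSquared k) := by
  rw [chiSquared, integrable_map_measure (by fun_prop)
    (Measurable.aemeasurable (by fun_prop))]
  exact integrable_finsetSum _ fun i _ => integrable_eval_sq k i

lemma integral_chiSquared (k : ℕ) : ∫ t, t ∂(chiSquared k) = k := by
  rw [chiSquared, integral_map (Measurable.aemeasurable (by fun_prop)) (by fun_prop),
    integral_finsetSum _ fun i _ => integrable_eval_sq k i]
  have h : ∀ i : Fin k, ∫ z : Fin k → ℝ, z i ^ 2 ∂(Measure.pi fun _ => gaussianReal 0 1) = 1 :=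
    fun i => by
    rw [integral_comp_eval (μ := fun _ : Fin k => gaussianReal 0 1) (i := i)
      (f := fun z : ℝ => z ^ 2) (by fun_prop), integral_sq_gaussianReal]
  simp [h]

end Gaussian

end BGGL

end
noncomputable section

namespace BGGL

open Set
open scoped RealInnerProductSpace ENNReal

/-! ### Integrability under the gamma law -/

section Gamma

variable {α β : ℝ}

/-- Moves to t > 0, where real powers obey the usual rules: the density vanishes for t < 0 and the
origin is null. -/
lemma lintegral_gammaMeasure (α β : ℝ) {f : ℝ → ℝ≥0∞} (hf : Measurable f) :
    ∫⁻ t, f t ∂(gammaMeasure α β) = ∫⁻ t in Ioi 0, gammaPDF α β t * f t := by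
  have hm : Measurable (gammaPDF α β) := (measurable_gammaPDFReal α β).ennreal_ofReal
  rw [gammaMeasure, lintegral_withDensity_eq_lintegral_mul _ hm hf,
    ← Measure.restrict_congr_set Ioi_ae_eq_Ici.symm,
    ← lintegral_add_compl _ (measurableSet_Ici (a := (0 : ℝ)))]
  rw [setLIntegral_congr_fun (g := fun _ => 0) (measurableSet_Ici.compl), lintegral_zero, add_zero]
  · rfl
  · intro t ht
    simp only [mem_compl_iff, mem_Ici, not_le] at ht
    simp [gammaPDF_of_neg ht]

lemma ae_pos_gammaMeasure (α β : ℝ) : ∀ᵐ t ∂(gammaMeasure α β), 0 < t := by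
  rw [ae_iff]
  have h := lintegral_gammaMeasure α β (f := indicator (Iic 0) 1)
    (measurable_one.indicator measurableSet_Iic)
  rw [lintegral_indicator_one measurableSet_Iic,
    setLIntegral_congr_fun (g := fun _ => 0) measurableSet_Ioi, lintegral_zero] at h
  · convert h using 2
    ext
    simp
  · intro t ht
    have : t ∉ Iic (0 : ℝ) := fun h => absurd (Set.mem_Ioi.1 ht) (not_lt.2 h)
    simp [this]

lemma gammaMeasure_singleton (α β s : ℝ) : gammaMeasure α β {s} = 0 :=
  withDensity_absolutelyContinuous _ _ (measure_singleton s)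

/-- On t > 0, t^r times the gamma density of shape α is a constant times that of shape α + r. -/
lemma lintegral_rpow_gammaMeasure_ne_top (hα : 0 < α) (hβ : 0 < β) {r : ℝ} (hr : -α < r) :
    ∫⁻ t, ENNReal.ofReal (t ^ r) ∂(gammaMeasure α β) ≠ ∞ := by
  have hα' : 0 < α + r := by linarith
  rw [lintegral_gammaMeasure _ _ (by fun_prop)]
  set C := β ^ α / Real.Gamma α / (β ^ (α + r) / Real.Gamma (α + r)) with hC
  have hG := Real.Gamma_pos_of_pos hα
  have hG' := Real.Gamma_pos_of_pos hα'
  have hm : Measurable (gammaPDF (α + r) β) := (measurable_gammaPDFReal _ _).ennreal_ofReal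
  have h : ∫⁻ t in Ioi 0, gammaPDF α β t * ENNReal.ofReal (t ^ r) =
      ∫⁻ t in Ioi 0, ENNReal.ofReal C * gammaPDF (α + r) β t := by
    refine setLIntegral_congr_fun measurableSet_Ioi fun t ht => ?_
    have ht : 0 < t := ht
    rw [gammaPDF_of_nonneg ht.le, gammaPDF_of_nonneg ht.le, ← ENNReal.ofReal_mul (by positivity),
      ← ENNReal.ofReal_mul (by positivity)]
    congr 1
    have e : t ^ (α + r - 1) = t ^ (α - 1) * t ^ r := by
      rw [← Real.rpow_add ht]
      ring_nf
    rw [e, hC]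
    have := (Real.rpow_pos_of_pos hβ (α + r)).ne'
    field_simp
  rw [h, lintegral_const_mul _ hm]
  refine ENNReal.mul_ne_top ENNReal.ofReal_ne_top (ne_top_of_le_ne_top ENNReal.one_ne_top ?_)
  rw [← lintegral_gammaPDF_eq_one hα' hβ]
  exact setLIntegral_le_lintegral _ _

/-- A kernel that dominates, for two pairs with a common point, the inverse square root of
`infoDet`. -/
def prox (s t : ℝ) : ℝ := √(√(s * t) / |t - s|)

lemma prox_nonneg (s t : ℝ) : 0 ≤ prox s t := Real.sqrt_nonneg _

@[fun_prop]
lemma measurable_prox : Measurable (fun p : ℝ × ℝ => prox p.1 p.2) := by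
  unfold prox
  fun_prop

/-- Off the diagonal at scale s the kernel is bounded; the constant is not sharp. -/
lemma prox_le_two {s t : ℝ} (hs : 0 < s) (ht : 0 < t) (h : s / 2 < |t - s|) : prox s t ≤ 2 := by
  have h0 : 0 < |t - s| := by linarith
  have h1 : √(s * t) ≤ 4 * |t - s| := by
    rw [Real.sqrt_le_left (by positivity), mul_pow, sq_abs]
    rcases lt_abs.1 h with h | h <;> nlinarith
  rw [prox, Real.sqrt_le_left (by norm_num), div_le_iff₀ h0]
  linarith

lemma prox_le_of_abs_sub_le {s t : ℝ} (hs : 0 < s) (h : |t - s| ≤ s / 2) :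
    prox s t ≤ √(2 * t) * (√|t - s|)⁻¹ := by
  have ht := (abs_le.1 h).1
  rw [prox, ← Real.sqrt_inv, ← Real.sqrt_mul (by linarith), div_eq_mul_inv]
  refine Real.sqrt_le_sqrt (mul_le_mul_of_nonneg_right ?_ (by positivity))
  rw [Real.sqrt_le_left (by linarith)]
  nlinarith

lemma lintegral_indicator_inv_sqrt_abs {r : ℝ} (hr : 0 < r) :
    ∫⁻ u : ℝ, ENNReal.ofReal (indicator (Iic r) (fun v => (√v)⁻¹) |u|) =
      ENNReal.ofReal (4 * √r) := by
  have h : ∫ u : ℝ, indicator (Iic r) (fun v => (√v)⁻¹) |u| = 4 * √r := by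
    rw [integral_comp_abs (f := indicator (Iic r) (fun v => (√v)⁻¹)),
      setIntegral_indicator measurableSet_Iic, Ioi_inter_Iic,
      ← intervalIntegral.integral_of_le hr.le]
    have e : ∀ v : ℝ, v ∈ uIcc 0 r → (√v)⁻¹ = v ^ (-(1 / 2) : ℝ) := fun v hv => by
      rw [uIcc_of_le hr.le] at hv
      rw [Real.rpow_neg hv.1, Real.sqrt_eq_rpow]
    rw [intervalIntegral.integral_congr e, integral_rpow (Or.inl (by norm_num)),
      Real.sqrt_eq_rpow]
    norm_num
    ring
  -- A nonintegrable function would have Bochner integral 0, contradicting the positive value in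
  -- `h`.
  have hi : Integrable (fun u : ℝ => indicator (Iic r) (fun v => (√v)⁻¹) |u|) := by
    by_contra hi
    rw [integral_undef hi] at h
    have := Real.sqrt_pos.2 hr
    linarith
  rw [← ofReal_integral_eq_lintegral_ofReal hi, h]
  exact ae_of_all _ fun u => indicator_nonneg (fun v _ => by positivity) _

/-- The inequality u ≤ exp u at u = bt/a, raised to the power a. -/
lemma rpow_mul_exp_neg_le {a b t : ℝ} (ha : 0 < a) (hb : 0 < b) (ht : 0 < t) :
    t ^ a * Real.exp (-(b * t)) ≤ (a / b) ^ a := by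
  have h1 : b * t / a ≤ Real.exp (b * t / a) := by
    linarith [Real.add_one_le_exp (b * t / a)]
  have h2 := Real.rpow_le_rpow (by positivity) h1 ha.le
  rw [← Real.exp_mul, div_mul_cancel₀ _ ha.ne'] at h2
  have h3 : t ^ a = (b * t / a) ^ a * (a / b) ^ a := by
    rw [← Real.mul_rpow (by positivity) (by positivity)]
    congr 1
    field_simp
  rw [h3, Real.exp_neg]
  have := Real.exp_pos (b * t)
  have : 0 ≤ (a / b) ^ a := by positivity
  calc (b * t / a) ^ a * (a / b) ^ a * (Real.exp (b * t))⁻¹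
      ≤ Real.exp (b * t) * (a / b) ^ a * (Real.exp (b * t))⁻¹ := by gcongr
    _ = (a / b) ^ a := by field_simp

/-- The kernel `prox` is integrable against weighted gamma laws, uniformly in the base point. -/
lemma exists_lintegral_prox_le (hα : 0 < α) (hβ : 0 < β) {q : ℝ} (hqα : q < α) :
    ∃ C : ℝ≥0∞, C ≠ ∞ ∧ ∀ s, 0 < s →
      ∫⁻ t, ENNReal.ofReal (t ^ (-q)) * ENNReal.ofReal (prox s t) ∂(gammaMeasure α β) ≤ C := by
  have hG := Real.Gamma_pos_of_pos hα
  set c := β ^ α / Real.Gamma α with hc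
  have hc0 : 0 < c := by positivity
  set M := ((α - q) / β) ^ (α - q) with hM
  have ha : 0 < α - q := by linarith
  have hM0 : 0 < M := by positivity
  set I := ∫⁻ t, ENNReal.ofReal (t ^ (-q)) ∂(gammaMeasure α β) with hI
  refine ⟨2 * I + ENNReal.ofReal (c * M * √2 * 4),
    ENNReal.add_ne_top.2 ⟨ENNReal.mul_ne_top ENNReal.ofNat_ne_top
      (lintegral_rpow_gammaMeasure_ne_top hα hβ (by linarith)), ENNReal.ofReal_ne_top⟩,
    fun s hs => ?_⟩
  have hr : 0 < s / 2 := by linarith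
  -- For |t - s| ≤ s/2, once t^(α-q)exp(-βt) ≤ M is extracted, a factor √2·t^(-1/2) ≤
  -- √2·(s/2)^(-1/2) remains. The integral of |t - s|^(-1/2) there is 4√(s/2), so s cancels and the
  -- bound is uniform. The other t contribute at most 2I.
  have hpt : ∀ t ∈ Ioi (0 : ℝ),
      gammaPDF α β t * (ENNReal.ofReal (t ^ (-q)) * ENNReal.ofReal (prox s t)) ≤
      2 * (gammaPDF α β t * ENNReal.ofReal (t ^ (-q))) +
        ENNReal.ofReal (c * M * √2 * (√(s / 2))⁻¹) *
          ENNReal.ofReal (indicator (Iic (s / 2)) (fun v => (√v)⁻¹) |t - s|) := by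
    intro t ht
    have ht : 0 < t := ht
    by_cases h : |t - s| ≤ s / 2
    · refine le_add_left ?_
      have hts := (abs_le.1 h).1
      rw [indicator_of_mem (show |t - s| ∈ Iic (s / 2) from h), gammaPDF_of_nonneg ht.le,
        ← ENNReal.ofReal_mul (by positivity), ← ENNReal.ofReal_mul (by positivity),
        ← ENNReal.ofReal_mul (by positivity)]
      refine ENNReal.ofReal_le_ofReal ?_
      have e : t ^ (α - 1) * t ^ (-q) = t ^ (α - q) * (t)⁻¹ := by
        rw [← Real.rpow_neg_one, ← Real.rpow_add ht, ← Real.rpow_add ht]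
        ring_nf
      have e2 : t⁻¹ * √(2 * t) = √2 * (√t)⁻¹ := by
        rw [Real.sqrt_mul (by norm_num)]
        have h1 := Real.sqrt_pos.2 ht
        have h2 := Real.sq_sqrt ht.le
        generalize √t = w at *
        rw [← h2]
        field_simp
      have hrt : (√t)⁻¹ ≤ (√(s / 2))⁻¹ :=
        inv_anti₀ (Real.sqrt_pos.2 hr) (Real.sqrt_le_sqrt (by linarith))
      calc c * t ^ (α - 1) * Real.exp (-(β * t)) * (t ^ (-q) * prox s t)
          ≤ c * t ^ (α - 1) * Real.exp (-(β * t)) *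
              (t ^ (-q) * (√(2 * t) * (√|t - s|)⁻¹)) := by
            gcongr
            exact prox_le_of_abs_sub_le hs h
        _ = c * (t ^ (α - q) * Real.exp (-(β * t))) * (t⁻¹ * √(2 * t)) * (√|t - s|)⁻¹ := by
            linear_combination (c * Real.exp (-(β * t)) * √(2 * t) * (√|t - s|)⁻¹) * e
        _ ≤ c * M * (√2 * (√(s / 2))⁻¹) * (√|t - s|)⁻¹ := by
            rw [e2]
            gcongr
            exact rpow_mul_exp_neg_le ha hβ ht
        _ = c * M * √2 * (√(s / 2))⁻¹ * (√|t - s|)⁻¹ := by ring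
    · refine le_add_right ?_
      have := prox_le_two hs ht (not_le.1 h)
      calc _ = ENNReal.ofReal (prox s t) * (gammaPDF α β t * ENNReal.ofReal (t ^ (-q))) := by ring
        _ ≤ _ := by
          gcongr
          exact ENNReal.ofReal_le_ofReal this |>.trans (by simp)
  have hmp : Measurable fun t => prox s t :=
    measurable_prox.comp (measurable_const.prodMk measurable_id)
  have hmg : Measurable (gammaPDF α β) := (measurable_gammaPDFReal α β).ennreal_ofReal
  have hmi : Measurable (fun u : ℝ =>
      ENNReal.ofReal (indicator (Iic (s / 2)) (fun v => (√v)⁻¹) |u|)) :=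
    ((Measurable.indicator (by fun_prop) measurableSet_Iic).comp measurable_abs).ennreal_ofReal
  rw [lintegral_gammaMeasure _ _ (by fun_prop)]
  refine (setLIntegral_mono' measurableSet_Ioi hpt).trans ?_
  rw [lintegral_add_left (by fun_prop), lintegral_const_mul _ (by fun_prop),
    ← lintegral_gammaMeasure _ _ (by fun_prop)]
  gcongr
  refine (setLIntegral_le_lintegral _ _).trans ?_
  have hms := hmi.comp (measurable_sub_const s)
  simp only [Function.comp_def] at hms
  rw [lintegral_const_mul _ hms,
    lintegral_sub_right_eq_self (fun u : ℝ =>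
      ENNReal.ofReal (indicator (Iic (s / 2)) (fun v => (√v)⁻¹) |u|)) s,
    lintegral_indicator_inv_sqrt_abs hr, ← ENNReal.ofReal_mul (by positivity)]
  refine ENNReal.ofReal_le_ofReal (le_of_eq ?_)
  have := (Real.sqrt_pos.2 hr).ne'
  field_simp

end Gamma

end BGGL

end
noncomputable section

namespace BGGL

open scoped RealInnerProductSpace ENNReal

/-! ### Null sets and integrability for gamma samples -/

section GammaPi

variable {α β : ℝ}

lemma ae_forall_pos_gammaPi (hα : 0 < α) (hβ : 0 < β) (n : ℕ) :
    ∀ᵐ x ∂(gammaPi α β n), ∀ i, 0 < x i := by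
  have := isProbabilityMeasure_gammaMeasure hα hβ
  exact ae_all_iff.2 fun i => (Measure.quasiMeasurePreserving_eval _ i).ae (ae_pos_gammaMeasure α β)

lemma ae_injective_gammaPi (hα : 0 < α) (hβ : 0 < β) (n : ℕ) :
    ∀ᵐ x ∂(gammaPi α β n), Function.Injective x := by
  have := isProbabilityMeasure_gammaMeasure hα hβ
  have key : ∀ i j : Fin n, i ≠ j → ∀ᵐ x ∂(gammaPi α β n), x i ≠ x j := by
    intro i j hij
    obtain _ | n := n
    · exact i.elim0
    obtain ⟨k, rfl⟩ := Fin.exists_succAbove_eq hij.symm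
    -- Isolating coordinate i, each slice of {xᵢ = xⱼ} with the other coordinates fixed is a
    -- singleton, and gamma laws have no atoms.
    have hp := measurePreserving_piFinSuccAbove (fun _ : Fin (n + 1) => gammaMeasure α β) i
    have h : ∀ᵐ p ∂((gammaMeasure α β).prod (Measure.pi fun _ : Fin n => gammaMeasure α β)),
        p.1 ≠ p.2 k := by
      have hs : MeasurableSet {p : ℝ × (Fin n → ℝ) | p.1 = p.2 k} :=
        measurableSet_eq_fun (by fun_prop) (by fun_prop)
      rw [ae_iff]
      simp only [not_not]
      rw [Measure.prod_apply_symm hs]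
      simp only [Set.preimage_ofPred_eq]
      simp only [Set.ofPred_eq_eq_singleton, gammaMeasure_singleton, lintegral_zero]
    exact hp.quasiMeasurePreserving.ae h
  filter_upwards [ae_all_iff.2 fun i => ae_all_iff.2 fun j => ae_all_iff.2 (key i j)] with x hx
  intro i j hij
  by_contra h
  exact hx i j h hij

lemma lintegral_prod_gammaPi (hα : 0 < α) (hβ : 0 < β) {n : ℕ} {g : Fin n → ℝ → ℝ≥0∞}
    (hg : ∀ i, Measurable (g i)) :
    ∫⁻ x, ∏ i, g i (x i) ∂(gammaPi α β n) = ∏ i, ∫⁻ t, g i t ∂(gammaMeasure α β) := by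
  have := isProbabilityMeasure_gammaMeasure hα hβ
  have hi : iIndepFun (fun (i : Fin n) (x : Fin n → ℝ) => g i (x i)) (gammaPi α β n) :=
    iIndepFun_pi (fun i => (hg i).aemeasurable)
  rw [lintegral_prod_eq_prod_lintegral_of_indepFun _ _ hi fun i =>
    (hg i).comp (measurable_pi_apply i)]
  refine Finset.prod_congr rfl fun i _ => ?_
  exact (measurePreserving_eval (fun _ : Fin n => gammaMeasure α β) i).lintegral_comp (hg i)

/-- A product of functions of pairs with a common coordinate is integrable when the factors are
integrable in the other coordinate, uniformly in the common one. -/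
lemma lintegral_star_gammaPi_ne_top (hα : 0 < α) (hβ : 0 < β) {m : ℕ} (i : Fin (m + 1))
    {f : ℝ → ℝ≥0∞} (hf : Measurable f) (hf' : ∫⁻ t, f t ∂(gammaMeasure α β) ≠ ∞)
    {g : Fin m → ℝ → ℝ → ℝ≥0∞} (hg : ∀ j, Measurable fun p : ℝ × ℝ => g j p.1 p.2)
    (hb : ∀ j, ∃ C : ℝ≥0∞, C ≠ ∞ ∧ ∀ s, 0 < s → ∫⁻ t, g j s t ∂(gammaMeasure α β) ≤ C) :
    ∫⁻ x, f (x i) * ∏ j, g j (x i) (x (i.succAbove j)) ∂(gammaPi α β (m + 1)) ≠ ∞ := by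
  have := isProbabilityMeasure_gammaMeasure hα hβ
  have := isProbabilityMeasure_gammaPi hα hβ m
  choose C hC hgC using hb
  have hp := measurePreserving_piFinSuccAbove (fun _ : Fin (m + 1) => gammaMeasure α β) i
  have hm : Measurable fun p : ℝ × (Fin m → ℝ) => f p.1 * ∏ j, g j p.1 (p.2 j) := by
    refine (hf.comp measurable_fst).mul (Finset.measurable_prod _ fun j _ => ?_)
    exact (hg j).comp (measurable_fst.prodMk ((measurable_pi_apply j).comp measurable_snd))
  have h1 : ∫⁻ x, f (x i) * ∏ j, g j (x i) (x (i.succAbove j)) ∂(gammaPi α β (m + 1)) =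
      ∫⁻ p, f p.1 * ∏ j, g j p.1 (p.2 j) ∂((gammaMeasure α β).prod (gammaPi α β m)) :=
    hp.lintegral_comp hm
  rw [h1, lintegral_prod _ hm.aemeasurable]
  have h2 : ∀ᵐ s ∂(gammaMeasure α β),
      ∫⁻ y, f s * ∏ j, g j s (y j) ∂(gammaPi α β m) ≤ f s * ∏ j, C j := by
    filter_upwards [ae_pos_gammaMeasure α β] with s hs
    have hgs : ∀ j, Measurable (g j s) := fun j =>
      (hg j).comp (measurable_const.prodMk measurable_id)
    have hgp : Measurable fun y : Fin m → ℝ => ∏ j, g j s (y j) :=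
      Finset.measurable_prod _ fun j _ => (hgs j).comp (measurable_pi_apply j)
    rw [lintegral_const_mul _ hgp, lintegral_prod_gammaPi hα hβ hgs]
    gcongr with j
    exact hgC j s hs
  refine ne_top_of_le_ne_top ?_ (lintegral_mono_ae h2)
  rw [lintegral_mul_const _ hf]
  exact ENNReal.mul_ne_top hf' (ENNReal.prod_ne_top fun j _ => hC j)

/-- A star centred at i: every leaf has weight t^(-q), and two leaves also carry `prox`. The
estimate for δ takes q = 0, r = 1/2; that for μ takes r = -q, q = 1/(2n). -/
lemma lintegral_prox_gammaPi_ne_top (hα : 0 < α) (hβ : 0 < β) {m : ℕ} (i : Fin (m + 3))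
    {q r : ℝ} (hq : q < α) (hr : -α < r) :
    ∫⁻ x, ENNReal.ofReal (x i ^ r) * ((∏ j, ENNReal.ofReal (x (i.succAbove j) ^ (-q))) *
      (ENNReal.ofReal (prox (x i) (x (i.succAbove 0))) *
        ENNReal.ofReal (prox (x i) (x (i.succAbove 1))))) ∂(gammaPi α β (m + 3)) ≠ ∞ := by
  let g : Fin (m + 2) → ℝ → ℝ → ℝ≥0∞ := fun j s t =>
    ENNReal.ofReal (t ^ (-q)) * if j = 0 ∨ j = 1 then ENNReal.ofReal (prox s t) else 1
  have h := lintegral_star_gammaPi_ne_top hα hβ i (f := fun t => ENNReal.ofReal (t ^ r))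
    (by fun_prop) (lintegral_rpow_gammaMeasure_ne_top hα hβ hr) (g := g) (fun j => by
      by_cases hj : j = 0 ∨ j = 1
      · simp only [g, if_pos hj]
        fun_prop
      · simp only [g, if_neg hj]
        fun_prop) (fun j => by
      by_cases hj : j = 0 ∨ j = 1
      · simp only [g, if_pos hj]
        exact exists_lintegral_prox_le hα hβ hq
      · simp only [g, if_neg hj, mul_one]
        exact ⟨_, lintegral_rpow_gammaMeasure_ne_top hα hβ (by linarith), fun _ _ => le_rfl⟩)
  convert h using 5 with x
  simp only [g, Finset.prod_mul_distrib]
  congr 1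
  rw [Fin.prod_univ_succ, Fin.prod_univ_succ, Finset.prod_eq_one]
  · simp
  · intro j _
    rw [if_neg]
    rw [not_or]
    refine ⟨Fin.succ_ne_zero _, fun h => ?_⟩
    rw [← Fin.succ_zero_eq_one] at h
    exact Fin.succ_ne_zero _ (Fin.succ_injective _ h)

/-- Since A² + B² ≥ AB, the singularity is shared between two pairs. A single pair would give |xᵢ -
xⱼ|^(-1), which is not integrable; this is why three points are needed. -/
lemma inv_sqrt_infoDet_le {n : ℕ} {x : Fin n → ℝ} (hx : ∀ i, 0 < x i)
    (hinj : Function.Injective x) {i j k : Fin n} (hij : i ≠ j) (hik : i ≠ k) (hjk : j ≠ k) :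
    (√(infoDet x))⁻¹ ≤ prox (x i) (x j) * prox (x i) (x k) := by
  have key := add_le_infoDet hx hij hik hjk
  have hi := hx i
  have hj := hx j
  have hk := hx k
  have aj : 0 < |x j - x i| := abs_pos.2 (sub_ne_zero.2 fun h => hij (hinj h.symm))
  have ak : 0 < |x k - x i| := abs_pos.2 (sub_ne_zero.2 fun h => hik (hinj h.symm))
  have sj : 0 < √(x i * x j) := Real.sqrt_pos.2 (by positivity)
  have sk : 0 < √(x i * x k) := Real.sqrt_pos.2 (by positivity)
  have e1 : (x i - x j) ^ 2 / (x i * x j) = (|x j - x i| / √(x i * x j)) ^ 2 := by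
    rw [div_pow, sq_abs, Real.sq_sqrt (by positivity)]
    ring
  have e2 : (x i - x k) ^ 2 / (x i * x k) = (|x k - x i| / √(x i * x k)) ^ 2 := by
    rw [div_pow, sq_abs, Real.sq_sqrt (by positivity)]
    ring
  rw [e1, e2] at key
  rw [prox, prox, ← Real.sqrt_mul (by positivity), ← Real.sqrt_inv]
  refine Real.sqrt_le_sqrt ?_
  rw [← inv_div |x j - x i|, ← inv_div |x k - x i|, ← mul_inv]
  refine inv_anti₀ (by positivity) ?_
  have hp : 0 < |x j - x i| / √(x i * x j) := by positivity
  have hp' : 0 < |x k - x i| / √(x i * x k) := by positivity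
  nlinarith [sq_nonneg (|x j - x i| / √(x i * x j) - |x k - x i| / √(x i * x k))]

lemma inv_sqrt_infoDet_le_succAbove {m : ℕ} {x : Fin (m + 3) → ℝ} (hx : ∀ i, 0 < x i)
    (hinj : Function.Injective x) (i : Fin (m + 3)) :
    (√(infoDet x))⁻¹ ≤ prox (x i) (x (i.succAbove 0)) * prox (x i) (x (i.succAbove 1)) :=
  inv_sqrt_infoDet_le hx hinj (Fin.succAbove_ne i 0).symm (Fin.succAbove_ne i 1).symm
    (fun h => zero_ne_one (Fin.succAbove_right_injective h))

lemma sqrt_sum_le {ι : Type*} (s : Finset ι) {f : ι → ℝ} (hf : ∀ i, 0 ≤ f i) :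
    √(∑ i ∈ s, f i) ≤ ∑ i ∈ s, √(f i) := by
  rw [Real.sqrt_le_left (Finset.sum_nonneg fun i _ => Real.sqrt_nonneg _)]
  calc ∑ i ∈ s, f i = ∑ i ∈ s, √(f i) ^ 2 :=
        Finset.sum_congr rfl fun i _ => (Real.sq_sqrt (hf i)).symm
    _ ≤ _ := Finset.sum_sq_le_sq_sum_of_nonneg fun i _ => Real.sqrt_nonneg _

lemma lintegral_sqrt_deltaVec_ne_top (hα : 0 < α) (hβ : 0 < β) {n : ℕ} (hn : 3 ≤ n) :
    ∫⁻ x, ENNReal.ofReal (√⟪deltaVec x, deltaVec x⟫) ∂(gammaPi α β n) ≠ ∞ := by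
  obtain ⟨m, rfl⟩ := Nat.exists_eq_add_of_le' hn
  -- √S ≤ ∑ √xᵢ, and the i-th term uses the star centred at i, so √xᵢ is a weight at the centre.
  have hbound : ∀ᵐ x ∂(gammaPi α β (m + 3)),
      ENNReal.ofReal (√⟪deltaVec x, deltaVec x⟫) ≤
      ∑ i, ENNReal.ofReal (x i ^ (1 / 2 : ℝ)) *
        ((∏ j, ENNReal.ofReal (x (i.succAbove j) ^ (-0 : ℝ))) *
        (ENNReal.ofReal (prox (x i) (x (i.succAbove 0))) *
        ENNReal.ofReal (prox (x i) (x (i.succAbove 1))))) := by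
    filter_upwards [ae_forall_pos_gammaPi hα hβ _, ae_injective_gammaPi hα hβ _] with x hx hinj
    have hD := infoDet_pos hx (i := 0) (j := 1) (fun h => zero_ne_one (hinj h))
    rw [inner_deltaVec_self hx hD, Real.sqrt_div' _ hD.le]
    have h : √(∑ i, x i) / √(infoDet x) ≤ ∑ i, x i ^ (1 / 2 : ℝ) *
        (prox (x i) (x (i.succAbove 0)) * prox (x i) (x (i.succAbove 1))) := by
      rw [div_eq_mul_inv]
      calc _ ≤ (∑ i, √(x i)) * (√(infoDet x))⁻¹ := by
            gcongr
            exact sqrt_sum_le _ fun i => (hx i).le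
        _ ≤ _ := by
            rw [Finset.sum_mul]
            refine Finset.sum_le_sum fun i _ => ?_
            rw [← Real.sqrt_eq_rpow]
            gcongr
            exact inv_sqrt_infoDet_le_succAbove hx hinj i
    refine (ENNReal.ofReal_le_ofReal h).trans (le_of_eq ?_)
    rw [ENNReal.ofReal_sum_of_nonneg fun i _ => by
      have := (hx i).le
      exact mul_nonneg (by positivity) (mul_nonneg (prox_nonneg _ _) (prox_nonneg _ _))]
    refine Finset.sum_congr rfl fun i _ => ?_
    have := (hx i).le
    rw [ENNReal.ofReal_mul (by positivity), ENNReal.ofReal_mul (prox_nonneg _ _)]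
    simp
  refine ne_top_of_le_ne_top ?_ (lintegral_mono_ae hbound)
  rw [lintegral_finsetSum]
  · refine ENNReal.sum_ne_top.2 fun i _ => ?_
    exact lintegral_prox_gammaPi_ne_top hα hβ i hα (by linarith)
  · intro i _
    fun_prop

/-- AM-GM spreads the power -1/2 evenly, so each coordinate needs only a moment of order -1/(2n). -/
lemma inv_sqrt_sum_le_prod {n : ℕ} (hn : n ≠ 0) {x : Fin n → ℝ} (hx : ∀ i, 0 < x i) :
    (√(∑ i, x i))⁻¹ ≤ ∏ i, x i ^ (-(1 / (2 * n)) : ℝ) := by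
  have hn' : (1 : ℝ) ≤ n := by exact_mod_cast Nat.one_le_iff_ne_zero.2 hn
  have hS : 0 ≤ ∑ i, x i := Finset.sum_nonneg fun i _ => (hx i).le
  have h := Real.geom_mean_le_arith_mean_weighted Finset.univ (fun _ : Fin n => (1 / n : ℝ)) x
    (fun _ _ => by positivity) (by simp; field_simp) (fun i _ => (hx i).le)
  rw [← Finset.mul_sum] at h
  have h2 : ∏ i, x i ^ (1 / n : ℝ) ≤ ∑ i, x i :=
    h.trans (mul_le_of_le_one_left hS (by rw [div_le_one (by linarith)]; exact hn'))
  have hpos : 0 < ∏ i, x i ^ (1 / n : ℝ) :=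
    Finset.prod_pos fun i _ => Real.rpow_pos_of_pos (hx i) _
  calc (√(∑ i, x i))⁻¹ ≤ (√(∏ i, x i ^ (1 / n : ℝ)))⁻¹ :=
        inv_anti₀ (Real.sqrt_pos.2 hpos) (Real.sqrt_le_sqrt h2)
    _ = ∏ i, x i ^ (-(1 / (2 * n)) : ℝ) := by
        rw [Real.sqrt_eq_rpow, ← Real.rpow_neg hpos.le,
          ← Real.finsetProd_rpow _ _ fun i _ => Real.rpow_nonneg (hx i).le _]
        refine Finset.prod_congr rfl fun i _ => ?_
        rw [← Real.rpow_mul (hx i).le]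
        congr 1
        field_simp

/-- Substituting H = (D + n²)/S trades negative moments of single covariates for those of their sum.
-/
lemma sqrt_sum_inv_div_infoDet_le {n : ℕ} {x : Fin n → ℝ} (hx : ∀ i, 0 < x i)
    (hD : 0 < infoDet x) :
    √((∑ i, (x i)⁻¹) / infoDet x) ≤
      (√(∑ i, x i))⁻¹ + n * ((√(∑ i, x i))⁻¹ * (√(infoDet x))⁻¹) := by
  have hn : n ≠ 0 := by
    rintro rfl
    simp [infoDet] at hD
  have : Nonempty (Fin n) := Fin.pos_iff_nonempty.1 (Nat.pos_of_ne_zero hn)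
  have hS : 0 < ∑ i, x i := Finset.sum_pos (fun i _ => hx i) Finset.univ_nonempty
  have e : (∑ i, (x i)⁻¹) / infoDet x = (∑ i, x i)⁻¹ * (1 + (n : ℝ) ^ 2 / infoDet x) := by
    have h : (∑ i, x i) * (∑ i, (x i)⁻¹) = infoDet x + (n : ℝ) ^ 2 := by
      simp [infoDet]
    generalize (∑ i, (x i)⁻¹) = H at *
    field_simp
    linarith
  rw [e, Real.sqrt_mul (by positivity), Real.sqrt_inv]
  have h1 : √(1 + (n : ℝ) ^ 2 / infoDet x) ≤ 1 + n * (√(infoDet x))⁻¹ := by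
    rw [Real.sqrt_le_left (by positivity), add_sq, mul_pow, inv_pow, Real.sq_sqrt hD.le,
      div_eq_mul_inv]
    have : 0 ≤ n * (√(infoDet x))⁻¹ := by positivity
    linarith
  calc _ ≤ (√(∑ i, x i))⁻¹ * (1 + n * (√(infoDet x))⁻¹) := by gcongr
    _ = _ := by ring

lemma lintegral_sqrt_muVec_ne_top (hα : 0 < α) (hβ : 0 < β) {n : ℕ} (hn : 3 ≤ n)
    (hnα : 1 / 2 < (n : ℝ) * α) :
    ∫⁻ x, ENNReal.ofReal (√⟪muVec x, muVec x⟫) ∂(gammaPi α β n) ≠ ∞ := by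
  set q : ℝ := 1 / (2 * n) with hq
  have hn0 : n ≠ 0 := by omega
  have hn' : (0 : ℝ) < n := by exact_mod_cast Nat.pos_of_ne_zero hn0
  have hqα : q < α := by
    rw [hq, div_lt_iff₀ (by positivity)]
    linarith
  clear_value q
  obtain ⟨m, rfl⟩ := Nat.exists_eq_add_of_le' hn
  have hbound : ∀ᵐ x ∂(gammaPi α β (m + 3)),
      ENNReal.ofReal (√⟪muVec x, muVec x⟫) ≤
      ∏ i, ENNReal.ofReal (x i ^ (-q)) + ((m + 3 : ℕ) : ℝ≥0∞) * (ENNReal.ofReal (x 0 ^ (-q)) *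
        ((∏ j, ENNReal.ofReal (x ((0 : Fin (m + 3)).succAbove j) ^ (-q))) *
        (ENNReal.ofReal (prox (x 0) (x ((0 : Fin (m + 3)).succAbove 0))) *
        ENNReal.ofReal (prox (x 0) (x ((0 : Fin (m + 3)).succAbove 1)))))) := by
    filter_upwards [ae_forall_pos_gammaPi hα hβ _, ae_injective_gammaPi hα hβ _] with x hx hinj
    have hD := infoDet_pos hx (i := 0) (j := 1) (fun h => zero_ne_one (hinj h))
    have hpow : ∀ i, 0 ≤ x i ^ (-q) := fun i => Real.rpow_nonneg (hx i).le _
    rw [inner_muVec_self hx hD]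
    have h : √((∑ i, (x i)⁻¹) / infoDet x) ≤ ∏ i, x i ^ (-q) +
        (m + 3 : ℕ) * ((∏ i, x i ^ (-q)) * (prox (x 0) (x ((0 : Fin (m + 3)).succAbove 0)) *
          prox (x 0) (x ((0 : Fin (m + 3)).succAbove 1)))) := by
      have h1 := inv_sqrt_sum_le_prod hn0 hx
      rw [← hq] at h1
      have h2 := inv_sqrt_infoDet_le_succAbove hx hinj 0
      have : 0 ≤ ∏ i, x i ^ (-q) := Finset.prod_nonneg fun i _ => hpow i
      refine (sqrt_sum_inv_div_infoDet_le hx hD).trans ?_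
      gcongr
    refine (ENNReal.ofReal_le_ofReal h).trans (le_of_eq ?_)
    have hpx := prox_nonneg
    have hP : 0 ≤ ∏ i, x i ^ (-q) := Finset.prod_nonneg fun i _ => hpow i
    rw [ENNReal.ofReal_add hP (mul_nonneg (Nat.cast_nonneg _) (mul_nonneg hP
      (mul_nonneg (hpx _ _) (hpx _ _)))), ENNReal.ofReal_mul (Nat.cast_nonneg _),
      ENNReal.ofReal_natCast, ENNReal.ofReal_mul hP, ENNReal.ofReal_mul (hpx _ _),
      ENNReal.ofReal_prod_of_nonneg fun i _ => hpow i]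
    congr 2
    rw [Fin.prod_univ_succAbove _ 0, mul_assoc]
  have hfin := lintegral_rpow_gammaMeasure_ne_top hα hβ (r := -q) (by linarith)
  refine ne_top_of_le_ne_top ?_ (lintegral_mono_ae hbound)
  rw [lintegral_add_left (Finset.measurable_prod _ fun i _ => by fun_prop),
    lintegral_const_mul _ (by fun_prop),
    lintegral_prod_gammaPi hα hβ (g := fun _ t => ENNReal.ofReal (t ^ (-q))) (by fun_prop)]
  refine ENNReal.add_ne_top.2 ⟨ENNReal.prod_ne_top fun _ _ => hfin,
    ENNReal.mul_ne_top (ENNReal.natCast_ne_top _) ?_⟩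
  exact lintegral_prox_gammaPi_ne_top hα hβ 0 hqα (by linarith)

end GammaPi

end BGGL

end
noncomputable section

namespace BGGL

open scoped RealInnerProductSpace ENNReal

/-! ### Laws and moments of the estimators -/

section Estimators

variable {Ω : Type*} [MeasurableSpace Ω] {P : Measure Ω} [IsProbabilityMeasure P] {n : ℕ}
  {X Y : Fin n → Ω → ℝ} {α β δ μ σ : ℝ}

@[fun_prop]
lemma measurable_deltaHat :
    Measurable fun p : (Fin n → ℝ) × (Fin n → ℝ) => deltaHat p.1 p.2 := by
  unfold deltaHat avg
  fun_prop

@[fun_prop]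
lemma measurable_muHat :
    Measurable fun p : (Fin n → ℝ) × (Fin n → ℝ) => muHat p.1 p.2 := by
  have h := measurable_deltaHat (n := n)
  unfold muHat avg
  fun_prop

@[fun_prop]
lemma measurable_upsilonHat :
    Measurable fun p : (Fin n → ℝ) × (Fin n → ℝ) => upsilonHat p.1 p.2 := by
  have h := measurable_deltaHat (n := n)
  have h' := measurable_muHat (n := n)
  unfold upsilonHat
  fun_prop

lemma measurable_deltaVec : Measurable (deltaVec : (Fin n → ℝ) → _) := by
  unfold deltaVec infoDet invSqrtVec sqrtVec
  fun_prop

lemma measurable_muVec : Measurable (muVec : (Fin n → ℝ) → _) := by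
  unfold muVec infoDet invSqrtVec sqrtVec
  fun_prop

lemma ae_infoDet_pos (hα : 0 < α) (hβ : 0 < β) (hn : 2 ≤ n) :
    ∀ᵐ x ∂(gammaPi α β n), (∀ i, 0 < x i) ∧ 0 < infoDet x := by
  filter_upwards [ae_forall_pos_gammaPi hα hβ n, ae_injective_gammaPi hα hβ n] with x hx hinj
  refine ⟨hx, infoDet_pos hx (i := ⟨0, by omega⟩) (j := ⟨1, by omega⟩) fun h => ?_⟩
  simpa using hinj h

/-- The joint law of a gamma covariate sample and an independent standard Gaussian noise. -/
def noiseLaw (α β : ℝ) (n : ℕ) : Measure ((Fin n → ℝ) × EuclideanSpace ℝ (Fin n)) :=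
  (gammaPi α β n).prod (stdGaussian _)

lemma isProbabilityMeasure_noiseLaw (hα : 0 < α) (hβ : 0 < β) (n : ℕ) :
    IsProbabilityMeasure (noiseLaw α β n) := by
  have := isProbabilityMeasure_gammaPi hα hβ n
  unfold noiseLaw
  infer_instance

lemma IsSample.hasLaw_comp (hα : 0 < α) (hβ : 0 < β) (h : IsSample P X Y α β δ μ σ)
    {B : Type*} [MeasurableSpace B] {F : (Fin n → ℝ) × (Fin n → ℝ) → B} (hF : Measurable F) :
    HasLaw (fun ω => F ((fun i => X i ω), (fun i => Y i ω)))
      ((noiseLaw α β n).map fun p => F (p.1, respond δ μ σ p.1 p.2)) P := by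
  have h1 := h.hasLaw_pair hα hβ
  refine ⟨hF.comp_aemeasurable h1.aemeasurable, ?_⟩
  have h2 := AEMeasurable.map_map_of_aemeasurable hF.aemeasurable h1.aemeasurable
  rw [h1.map_eq, Measure.map_map hF (by fun_prop)] at h2
  exact h2.symm

lemma measurable_comp_respond {T : (Fin n → ℝ) → (Fin n → ℝ) → ℝ}
    (hT : Measurable fun p : (Fin n → ℝ) × (Fin n → ℝ) => T p.1 p.2) (δ μ σ : ℝ) :
    Measurable fun p : (Fin n → ℝ) × EuclideanSpace ℝ (Fin n) => T p.1 (respond δ μ σ p.1 p.2) :=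
  hT.comp (measurable_fst.prodMk (measurable_respond δ μ σ))

/-- For fixed x the error is a centred linear form in the noise. Cauchy–Schwarz bounds its absolute
mean by ‖c x‖ times the mean of ‖z‖, so the finite mean of ‖c x‖ permits Fubini. -/
lemma IsSample.isUnbiased_eval (hα : 0 < α) (hβ : 0 < β) (h : IsSample P X Y α β δ μ σ)
    {T : (Fin n → ℝ) → (Fin n → ℝ) → ℝ}
    (hT : Measurable fun p : (Fin n → ℝ) × (Fin n → ℝ) => T p.1 p.2)
    {c : (Fin n → ℝ) → EuclideanSpace ℝ (Fin n)} (hc : Measurable c) (θ τ : ℝ)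
    (hTc : ∀ᵐ x ∂(gammaPi α β n), ∀ z, T x (respond δ μ σ x z) = θ + τ * ⟪c x, z⟫)
    (hint : ∫⁻ x, ENNReal.ofReal (√⟪c x, c x⟫) ∂(gammaPi α β n) ≠ ∞) :
    IsUnbiased P (eval T X Y) θ := by
  have := isProbabilityMeasure_gammaPi hα hβ n
  have := isProbabilityMeasure_noiseLaw hα hβ n
  have hlaw := h.hasLaw_comp hα hβ hT
  have hm : Measurable fun p : (Fin n → ℝ) × EuclideanSpace ℝ (Fin n) =>
      T p.1 (respond δ μ σ p.1 p.2) := measurable_comp_respond hT δ μ σ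
  have hinner : Integrable (fun p : (Fin n → ℝ) × EuclideanSpace ℝ (Fin n) => ⟪c p.1, p.2⟫)
      (noiseLaw α β n) := by
    have hmi : Measurable fun p : (Fin n → ℝ) × EuclideanSpace ℝ (Fin n) => ⟪c p.1, p.2⟫ := by
      fun_prop
    refine ⟨hmi.aestronglyMeasurable, ?_⟩
    rw [HasFiniteIntegral, noiseLaw, lintegral_prod _ (by fun_prop)]
    refine lt_of_le_of_lt (lintegral_mono fun x => lintegral_enorm_inner_stdGaussian_le (c x)) ?_
    rw [lintegral_mul_const _ (by fun_prop)]
    exact ENNReal.mul_lt_top hint.lt_top lintegral_enorm_stdGaussian_ne_top.lt_top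
  have hae : (fun p : (Fin n → ℝ) × EuclideanSpace ℝ (Fin n) => T p.1 (respond δ μ σ p.1 p.2))
      =ᵐ[noiseLaw α β n] fun p => θ + τ * ⟪c p.1, p.2⟫ := by
    filter_upwards [Measure.quasiMeasurePreserving_fst.ae hTc] with p hp
    exact hp p.2
  constructor
  · have h1 : Integrable (fun p : (Fin n → ℝ) × EuclideanSpace ℝ (Fin n) =>
        T p.1 (respond δ μ σ p.1 p.2)) (noiseLaw α β n) :=
      ((integrable_const θ).add (hinner.const_mul τ)).congr hae.symm
    have h2 : Integrable id (P.map (eval T X Y)) := by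
      rw [show P.map (eval T X Y) = _ from hlaw.map_eq,
        integrable_map_measure (by fun_prop) hm.aemeasurable]
      exact h1
    exact (integrable_map_measure (by fun_prop) hlaw.aemeasurable).1 h2
  · have h0 : ∫ p, ⟪c p.1, p.2⟫ ∂(noiseLaw α β n) = 0 := by
      rw [noiseLaw, integral_prod _ hinner]
      simp [integral_inner_stdGaussian]
    have h1 : ∫ ω, eval T X Y ω ∂P = ∫ t, t ∂_ := hlaw.integral_eq
    rw [h1, integral_map hm.aemeasurable (by fun_prop), integral_congr_ae hae,
      integral_add (integrable_const θ) (hinner.const_mul τ), integral_const_mul, h0]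
    simp

/-- A conditional law that does not depend on the condition is the unconditional law. -/
lemma map_prod_eq_of_ae {A B C : Type*} [MeasurableSpace A] [MeasurableSpace B]
    [MeasurableSpace C] {G : Measure A} [IsProbabilityMeasure G] {N : Measure B} [SFinite N]
    {ρ : Measure C} {F : A × B → C} (hF : Measurable F)
    (h : ∀ᵐ a ∂G, N.map (fun b => F (a, b)) = ρ) : (G.prod N).map F = ρ := by
  ext s hs
  rw [Measure.map_apply hF hs, Measure.prod_apply (hF hs)]
  have : ∀ᵐ a ∂G, N (Prod.mk a ⁻¹' (F ⁻¹' s)) = ρ s := by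
    filter_upwards [h] with a ha
    rw [← ha, Measure.map_apply (by fun_prop) hs]
    rfl
  rw [lintegral_congr_ae this]
  simp

lemma IsSample.hasLaw_upsilonHat (hα : 0 < α) (hβ : 0 < β) (hσ : 0 < σ) (hn : 2 ≤ n)
    (h : IsSample P X Y α β δ μ σ) :
    HasLaw (fun ω => n * eval upsilonHat X Y ω / σ ^ 2) (chiSquared (n - 2)) P := by
  have := isProbabilityMeasure_gammaPi hα hβ n
  have hlaw := h.hasLaw_comp hα hβ
    (F := fun p : (Fin n → ℝ) × (Fin n → ℝ) => n * upsilonHat p.1 p.2 / σ ^ 2) (by fun_prop)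
  refine ⟨hlaw.aemeasurable, Eq.trans hlaw.map_eq ?_⟩
  have hm : Measurable fun p : (Fin n → ℝ) × EuclideanSpace ℝ (Fin n) =>
      n * upsilonHat p.1 (respond δ μ σ p.1 p.2) / σ ^ 2 :=
    ((measurable_comp_respond measurable_upsilonHat δ μ σ).const_mul (n : ℝ)).div_const _
  refine map_prod_eq_of_ae hm ?_
  filter_upwards [ae_infoDet_pos hα hβ hn] with x hx
  have hn' : (n : ℝ) ≠ 0 := by
    have : n ≠ 0 := by omega
    exact_mod_cast this
  have e : (fun z => n * upsilonHat x (respond δ μ σ x z) / σ ^ 2) =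
      (fun v : residualSpace x => ‖v‖ ^ 2) ∘ (residualSpace x).orthogonalProjectionOnto := by
    ext z
    rw [upsilonHat_respond hx.1 hx.2]
    have := hσ.ne'
    simp only [Function.comp_apply]
    field_simp
  rw [e, ← Measure.map_map (by fun_prop) (by fun_prop), map_orthogonalProjection_stdGaussian,
    map_norm_sq_stdGaussian, finrank_residualSpace hx.1 hx.2]

lemma IsSample.integrable_upsilonHat (hα : 0 < α) (hβ : 0 < β) (hσ : 0 < σ) (hn : 2 ≤ n)
    (h : IsSample P X Y α β δ μ σ) :
    Integrable (eval upsilonHat X Y) P := by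
  have hlaw := h.hasLaw_upsilonHat hα hβ hσ hn
  have h1 : Integrable (fun ω => n * eval upsilonHat X Y ω / σ ^ 2) P := by
    have h2 : Integrable (fun t => t) (P.map fun ω => n * eval upsilonHat X Y ω / σ ^ 2) := by
      rw [hlaw.map_eq]
      exact integrable_chiSquared _
    exact (integrable_map_measure (by fun_prop) hlaw.aemeasurable).1 h2
  refine (h1.const_mul (σ ^ 2 / n)).congr (ae_of_all _ fun ω => ?_)
  have hn' : (n : ℝ) ≠ 0 := by
    have : n ≠ 0 := by omega
    exact_mod_cast this
  have := hσ.ne'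
  simp only
  field_simp

lemma IsSample.integral_upsilonHat (hα : 0 < α) (hβ : 0 < β) (hσ : 0 < σ) (hn : 2 ≤ n)
    (h : IsSample P X Y α β δ μ σ) :
    ∫ ω, eval upsilonHat X Y ω ∂P = σ ^ 2 * ((n - 2) / n) := by
  have hlaw := h.hasLaw_upsilonHat hα hβ hσ hn
  have h1 := hlaw.integral_eq
  rw [integral_chiSquared, integral_div, integral_const_mul] at h1
  -- `hn` turns the truncated subtraction n - 2 into a real one.
  push_cast [hn] at h1
  have hn' : (n : ℝ) ≠ 0 := by
    have : n ≠ 0 := by omega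
    exact_mod_cast this
  have := hσ.ne'
  field_simp at h1 ⊢
  linarith

lemma IsSample.ae_covariates (hα : 0 < α) (hβ : 0 < β) (h : IsSample P X Y α β δ μ σ)
    {p : (Fin n → ℝ) → Prop} (hp : ∀ᵐ x ∂(gammaPi α β n), p x) :
    ∀ᵐ ω ∂P, p fun i => X i ω := by
  have := isProbabilityMeasure_gammaPi hα hβ n
  have hlaw := h.hasLaw_comp hα hβ (F := Prod.fst) measurable_fst
  refine ae_of_ae_map hlaw.aemeasurable ?_
  rw [hlaw.map_eq, noiseLaw]
  simp only [Measure.map_fst_prod, measure_univ, one_smul]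
  exact hp

lemma IsSample.condDistrib_estimators (hα : 0 < α) (hβ : 0 < β) (hn : 2 ≤ n)
    (h : IsSample P X Y α β δ μ σ) :
    ∀ᵐ ω ∂P, condDistrib
        (fun ω => (!₂[eval deltaHat X Y ω, eval muHat X Y ω] : EuclideanSpace ℝ (Fin 2)))
        (fun ω i => X i ω) P (fun i => X i ω) =
      multivariateGaussian (!₂[δ, μ] : EuclideanSpace ℝ (Fin 2))
        (σ ^ 2 • (infoMatrix (fun i => X i ω))⁻¹) := by
  have := isProbabilityMeasure_gammaPi hα hβ n
  let T : (Fin n → ℝ) × (Fin n → ℝ) → EuclideanSpace ℝ (Fin 2) := fun p =>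
    !₂[deltaHat p.1 p.2, muHat p.1 p.2]
  have hT : Measurable T := by
    refine (WithLp.measurable_toLp 2 _).comp (measurable_pi_iff.2 fun i => ?_)
    fin_cases i
    · exact measurable_deltaHat
    · exact measurable_muHat
  let Ψ : (Fin n → ℝ) × EuclideanSpace ℝ (Fin n) → EuclideanSpace ℝ (Fin 2) := fun p =>
    T (p.1, respond δ μ σ p.1 p.2)
  have hΨ : Measurable Ψ := hT.comp (measurable_fst.prodMk (measurable_respond δ μ σ))
  let N : Measure (EuclideanSpace ℝ (Fin n)) := stdGaussian _
  -- The candidate conditional law: x is kept fixed and fresh noise is fed in. It disintegrates the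
  -- joint law, so it is the conditional distribution almost everywhere.
  let κ : Kernel (Fin n → ℝ) (EuclideanSpace ℝ (Fin 2)) :=
    (Kernel.id ×ₖ Kernel.const _ N).map Ψ
  have : IsMarkovKernel κ := Kernel.IsMarkovKernel.map _ hΨ
  have hκ : ∀ x, κ x = N.map fun z => Ψ (x, z) := fun x => by
    rw [Kernel.map_apply _ hΨ, Kernel.prod_apply, Kernel.id_apply, Kernel.const_apply,
      Measure.dirac_prod, Measure.map_map hΨ (by fun_prop)]
    rfl
  have hX := h.hasLaw_comp hα hβ (F := Prod.fst) measurable_fst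
  have hXG : P.map (fun ω i => X i ω) = gammaPi α β n := by
    have := hX.map_eq
    rw [noiseLaw] at this
    simpa only [Measure.map_fst_prod, measure_univ, one_smul] using this
  have hE := h.hasLaw_comp hα hβ hT
  have hXE := h.hasLaw_comp hα hβ (F := fun p => (p.1, T p)) (measurable_fst.prodMk hT)
  have hcomp : P.map (fun ω => ((fun i => X i ω), T ((fun i => X i ω), (fun i => Y i ω)))) =
      P.map (fun ω i => X i ω) ⊗ₘ κ := by
    rw [hXE.map_eq, hXG, noiseLaw]
    ext s hs
    have hm : Measurable fun p : (Fin n → ℝ) × EuclideanSpace ℝ (Fin n) => (p.1, Ψ p) :=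
      measurable_fst.prodMk hΨ
    rw [Measure.compProd_apply hs, Measure.map_apply hm hs, Measure.prod_apply (hm hs)]
    refine lintegral_congr fun x => ?_
    rw [hκ, Measure.map_apply (by fun_prop) (measurable_prodMk_left hs)]
    rfl
  have hcd := condDistrib_ae_eq_of_measure_eq_compProd (fun ω i => X i ω) hE.aemeasurable hcomp
  rw [hXG] at hcd
  refine h.ae_covariates hα hβ (p := fun x => condDistrib
        (fun ω => (!₂[eval deltaHat X Y ω, eval muHat X Y ω] : EuclideanSpace ℝ (Fin 2)))
        (fun ω i => X i ω) P x = multivariateGaussian (!₂[δ, μ] : EuclideanSpace ℝ (Fin 2))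
        (σ ^ 2 • (infoMatrix x)⁻¹)) ?_
  filter_upwards [hcd, ae_infoDet_pos hα hβ hn] with x hx hpos
  refine hx.trans ?_
  rw [hκ]
  have e : (fun z => Ψ (x, z)) =
      fun z => !₂[δ + σ * ⟪deltaVec x, z⟫, μ + σ * ⟪muVec x, z⟫] := by
    ext1 z
    simp only [Ψ, T, deltaHat_respond hpos.1 hpos.2, muHat_respond hpos.1 hpos.2]
  rw [e]
  refine map_pair_stdGaussian δ μ σ _ _ ?_ ?_
  · rw [inv_infoMatrix hpos.2, inner_deltaVec_self hpos.1 hpos.2, inner_muVec_self hpos.1 hpos.2,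
      inner_deltaVec_muVec hpos.1 hpos.2]
  · exact (posDef_infoMatrix hpos.1 hpos.2).inv.posSemidef.smul (sq_nonneg σ)

end Estimators

end BGGL

end

/-! ### The main theorem -/

theorem theorem3p2 (α β δ μ σ : ℝ) (hα : 0 < α) (hβ : 0 < β) (hσ : 0 < σ)
    {Ω : ℕ → Type*} [∀ n, MeasurableSpace (Ω n)]
    (P : ∀ n, Measure (Ω n)) [∀ n, IsProbabilityMeasure (P n)]
    (X Y : ∀ n, Fin n → Ω n → ℝ)
    (hXY : ∀ n, BGGL.IsSample (P n) (X n) (Y n) α β δ μ σ) :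
    -- unbiasedness of the estimators of `δ` and `μ`
    (∀ n : ℕ, 3 ≤ n → BGGL.IsUnbiased (P n) (BGGL.eval BGGL.deltaHat (X n) (Y n)) δ) ∧
    (∀ n : ℕ, 3 ≤ n → 1 / 2 < (n : ℝ) * α →
      BGGL.IsUnbiased (P n) (BGGL.eval BGGL.muHat (X n) (Y n)) μ) ∧
    -- their conditional joint distribution given `X 0, …, X (n-1)`
    (∀ n : ℕ, 2 ≤ n → ∀ᵐ ω ∂(P n),
      condDistrib
          (fun ω => (!₂[BGGL.eval BGGL.deltaHat (X n) (Y n) ω,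
            BGGL.eval BGGL.muHat (X n) (Y n) ω] : EuclideanSpace ℝ (Fin 2)))
          (fun ω i => X n i ω) (P n) (fun i => X n i ω) =
        multivariateGaussian (!₂[δ, μ] : EuclideanSpace ℝ (Fin 2))
          (σ ^ 2 • (BGGL.infoMatrix (fun i => X n i ω))⁻¹)) ∧
    -- the covariance matrix above is almost surely genuine
    (∀ n : ℕ, 2 ≤ n → ∀ᵐ ω ∂(P n), (BGGL.infoMatrix (fun i => X n i ω)).PosDef) ∧
    -- the estimator of `σ²` is biased, but asymptotically unbiased
    (∀ n : ℕ, 2 ≤ n →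
      BGGL.IsBiased (P n) (BGGL.eval BGGL.upsilonHat (X n) (Y n)) (σ ^ 2)) ∧
    Tendsto (fun n : ℕ => ∫ ω, BGGL.eval BGGL.upsilonHat (X n) (Y n) ω ∂(P n)) atTop
      (𝓝 (σ ^ 2)) ∧
    -- the corrected estimator is unbiased and has a scaled chi-squared distribution
    (∀ n : ℕ, 3 ≤ n →
      BGGL.IsUnbiased (P n) (BGGL.eval BGGL.sSq (X n) (Y n)) (σ ^ 2) ∧
      HasLaw (fun ω => ((n : ℝ) - 2) * BGGL.eval BGGL.sSq (X n) (Y n) ω / σ ^ 2)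
        (BGGL.chiSquared (n - 2)) (P n)) := by
  have hδ : ∀ n : ℕ, 3 ≤ n →
      BGGL.IsUnbiased (P n) (BGGL.eval BGGL.deltaHat (X n) (Y n)) δ := fun n hn => by
    refine (hXY n).isUnbiased_eval hα hβ BGGL.measurable_deltaHat BGGL.measurable_deltaVec δ σ ?_
      (BGGL.lintegral_sqrt_deltaVec_ne_top hα hβ hn)
    filter_upwards [BGGL.ae_infoDet_pos hα hβ (by omega)] with x hx z
    exact BGGL.deltaHat_respond hx.1 hx.2 δ μ σ z
  have hμ : ∀ n : ℕ, 3 ≤ n → 1 / 2 < (n : ℝ) * α →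
      BGGL.IsUnbiased (P n) (BGGL.eval BGGL.muHat (X n) (Y n)) μ := fun n hn hnα => by
    refine (hXY n).isUnbiased_eval hα hβ BGGL.measurable_muHat BGGL.measurable_muVec μ σ ?_
      (BGGL.lintegral_sqrt_muVec_ne_top hα hβ hn hnα)
    filter_upwards [BGGL.ae_infoDet_pos hα hβ (by omega)] with x hx z
    exact BGGL.muHat_respond hx.1 hx.2 δ μ σ z
  refine ⟨hδ, hμ, fun n hn => (hXY n).condDistrib_estimators hα hβ hn, fun n hn => ?_,
    fun n hn => ⟨(hXY n).integrable_upsilonHat hα hβ hσ hn, ?_⟩, ?_, fun n hn => ⟨⟨?_, ?_⟩, ?_⟩⟩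
  · refine (hXY n).ae_covariates hα hβ (p := fun x => (BGGL.infoMatrix x).PosDef) ?_
    filter_upwards [BGGL.ae_infoDet_pos hα hβ hn] with x hx
    exact BGGL.posDef_infoMatrix hx.1 hx.2
  · rw [(hXY n).integral_upsilonHat hα hβ hσ hn]
    have hn' : (0 : ℝ) < n := by exact_mod_cast (by omega : 0 < n)
    refine (mul_lt_of_lt_one_right (by positivity) ?_).ne
    rw [div_lt_one hn']
    linarith
  -- The mean formula is available from n = 2 on, which suffices for the limit.
  · have h : (fun n : ℕ => σ ^ 2 * (1 - 2 / (n : ℝ))) =ᶠ[atTop]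
        fun n => ∫ ω, BGGL.eval BGGL.upsilonHat (X n) (Y n) ω ∂(P n) := by
      filter_upwards [eventually_ge_atTop 2] with n hn
      rw [(hXY n).integral_upsilonHat hα hβ hσ hn]
      have hn' : (n : ℝ) ≠ 0 := by exact_mod_cast (by omega : n ≠ 0)
      field_simp
    refine Tendsto.congr' h ?_
    have h2 := (tendsto_const_div_atTop_nhds_zero_nat (2 : ℝ)).const_sub 1 |>.const_mul (σ ^ 2)
    simpa using h2
  · exact ((hXY n).integrable_upsilonHat hα hβ hσ (by omega)).const_mul _
  · have hn' : (3 : ℝ) ≤ n := by exact_mod_cast hn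
    simp only [BGGL.eval, BGGL.sSq]
    rw [integral_const_mul]
    have h := (hXY n).integral_upsilonHat hα hβ hσ (by omega : 2 ≤ n)
    simp only [BGGL.eval] at h
    rw [h]
    have h1 : (n : ℝ) - 2 ≠ 0 := by linarith
    have h2 : (n : ℝ) ≠ 0 := by linarith
    field_simp
  · have hn' : (3 : ℝ) ≤ n := by exact_mod_cast hn
    have h1 : (n : ℝ) - 2 ≠ 0 := by linarith
    refine ((hXY n).hasLaw_upsilonHat hα hβ hσ (by omega : 2 ≤ n)).congr (ae_of_all _ fun ω => ?_)
    simp only [BGGL.eval, BGGL.sSq]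
    field_simp
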